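/- Let $d\ge 1$ and let $k:\mathbb{R}^d\times\mathbb{R}^d\to\mathbb{R}$ be a continuous, bounded, translation-invariant (symmetric positive semidefinite) kernel, write $k(\mathbf{x}-\mathbf{y})=k(\mathbf{x},\mathbf{y})$, and let $\Lambda$ be its spectral measure, $k(\mathbf{x}-\mathbf{y})=\int_{\mathbb{R}^d} e^{i\mathbf{w}^\top(\mathbf{x}-\mathbf{y})}\,d\Lambda(\mathbf{w})$, normalized to be a probability measure. Suppose that for some $S,R>0$ $$\mathbb{E}_{\mathbf{w}\sim\Lambda}\big[|w_i|^{2n}\big]\le \frac{n!\,S^2R^{n-2}}{2}\qquad\text{for all } i\in\{1,\dots,d\}\text{ and all integers } n\ge 2 .$$ Let $\mathcal{X}\subset\mathbb{R}^d$ be compact and convex with diameter $|\mathcal{X}|$, and $\mathcal{X}_\Delta=\{\mathbf{x}-\mathbf{y}:\mathbf{x},\mathbf{y}\in\mathcal{X}\}$. Then $k$ is three times continuously differentiable (as a function on $\mathbb{R}^d$), and the following quantities are finite for all $i,j\in\{1,\dots,d\}$: $\sigma_\Lambda^2=\mathbb{E}_{\mathbf{w}\sim\Lambda}[\|\mathbf{w}\|_2^2]$,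 $L=\|\mathbb{E}_{\mathbf{w}\sim\Lambda}[\mathbf{w}\mathbf{w}^\top]\|_2^{1/2}$ (spectral norm), $E_{i,j}=\mathbb{E}_{\mathbf{w}\sim\Lambda}[|w_iw_j|\,\|\mathbf{w}\|_2]$ and $D_{i,j}=\sup_{\mathbf{z}\in\mathcal{X}_\Delta}\big\|\nabla\big[\tfrac{\partial^2 k(\mathbf{z})}{\partial z_i\partial z_j}\big]\big\|_2$. Let $\mathsf{Seq}(\mathcal{X})$ be the set of sequences $\mathbf{x}=(\mathbf{x}_0,\dots,\mathbf{x}_\ell)$ in $\mathcal{X}$ with $\ell=\ell_{\mathbf{x}}\ge 1$, let $\|\mathbf{x}\|_{1\text{-var}}=\sum_{i=1}^{\ell}\|\mathbf{x}_i-\mathbf{x}_{i-1}\|_2$, and let $\Delta_m(\ell)$ be the set of tuples $1\le i_1<\dots<i_m\le\ell$. For a function $\kappa$ on $\mathbb{R}^d\times\mathbb{R}^d$ put $\delta_{i,j}\kappa(\mathbf{x},\mathbf{y})=\kappa(\mathbf{x}_i,\mathbf{y}_j)-\kappa(\mathbf{x}_i,\mathbf{y}_{j-1})-\kappa(\mathbf{x}_{i-1},\mathbf{y}_j)+\kappa(\mathbf{x}_{i-1},\mathbf{y}_{j-1})$.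 The level-$m$ discretized signature kernel is $$k_{\mathsf S,m}(\mathbf{x},\mathbf{y})=\sum_{\mathbf{i}\in\Delta_m(\ell_{\mathbf{x}})}\ \sum_{\mathbf{j}\in\Delta_m(\ell_{\mathbf{y}})}\ \prod_{p=1}^m\delta_{i_p,j_p}k(\mathbf{x},\mathbf{y}).$$ For $\tilde d\ge 1$ let $\mathbf{w}^{(p)}_j$ ($1\le p\le m$, $1\le j\le\tilde d$) be i.i.d. with law $\Lambda$, let $\tilde\varphi_p(\mathbf{x})=\tilde d^{-1/2}\big(\cos(\mathbf{w}_j^{(p)\top}\mathbf{x}),\,\sin(\mathbf{w}_j^{(p)\top}\mathbf{x})\big)_{j=1}^{\tilde d}\in\mathbb{R}^{2\tilde d}$, and let the level-$m$ Random Fourier Signature Feature kernel be $$\tilde k_{\mathsf S,m}(\mathbf{x},\mathbf{y})=\Big\langle\sum_{\mathbf{i}\in\Delta_m(\ell_{\mathbf{x}})}\bigotimes_{p=1}^m\big(\tilde\varphi_p(\mathbf{x}_{i_p})-\tilde\varphi_p(\mathbf{x}_{i_p-1})\big),\ \sum_{\mathbf{j}\in\Delta_m(\ell_{\mathbf{y}})}\bigotimes_{p=1}^m\big(\tilde\varphi_p(\mathbf{y}_{j_p})-\tilde\varphi_p(\mathbf{y}_{j_p-1})\big)\Big\rangle_{(\mathbb{R}^{2\tilde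 d})^{\otimes m}} .$$ Then for all integers $m,\tilde d\ge 1$ and all $V,\epsilon>0$, $$\mathbb{P}\Bigg[\sup_{\substack{\mathbf{x},\mathbf{y}\in\mathsf{Seq}(\mathcal{X})\\ \|\mathbf{x}\|_{1\text{-var}},\|\mathbf{y}\|_{1\text{-var}}\le V}}\big|k_{\mathsf S,m}(\mathbf{x},\mathbf{y})-\tilde k_{\mathsf S,m}(\mathbf{x},\mathbf{y})\big|\ge\epsilon\Bigg]\le m\begin{cases}\Big(C_{d,\mathcal{X}}\big(\tfrac{\beta_{d,m,V}}{\epsilon}\big)^{\frac{d}{d+1}}+c_{d,m}\Big)\exp\Big(-\tfrac{\tilde d}{2(d+1)(S^2+R)}\big(\tfrac{\epsilon}{\beta_{d,m,V}}\big)^2\Big),&\epsilon<\beta_{d,m,V},\\[2mm]\Big(C_{d,\mathcal{X}}\big(\tfrac{\beta_{d,m,V}}{\epsilon}\big)^{\frac{d}{(d+1)m}}+c_{d,m}\Big)\exp\Big(-\tfrac{\tilde d}{2(d+1)(S^2+R)}\big(\tfrac{\epsilon}{\beta_{d,m,V}}\big)^{\frac1m}\Big),&\epsilon\ge\beta_{d,m,V},\end{cases}$$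 where $C_{d,\mathcal{X}}=2^{\frac1{d+1}}\,16\,|\mathcal{X}|^{\frac d{d+1}}\sum_{i,j=1}^d(D_{i,j}+E_{i,j})^{\frac d{d+1}}$, $\beta_{d,m,V}=m\big(2V^2(L^2\vee 1)(\sigma_\Lambda^2\vee d)\big)^m$, and $c_{d,m}=d$, except that $c_{1,1}=2$. -/

import Mathlib

open MeasureTheory ProbabilityTheory
open scoped ENNReal InnerProductSpace

noncomputable section

namespace RFSF

/-- A kernel on `ℝᵈ`: a symmetric, positive semidefinite function of two variables
(for every finite family of points the Gram matrix is positive semidefinite). -/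
def IsKernel {d : ℕ} (k : EuclideanSpace ℝ (Fin d) → EuclideanSpace ℝ (Fin d) → ℝ) : Prop :=
  (Matrix.of k).PosSemidef

/-- `k x y = k (x + z) (y + z)` for all `x, y, z`. -/
def IsTranslationInvariant {d : ℕ}
    (k : EuclideanSpace ℝ (Fin d) → EuclideanSpace ℝ (Fin d) → ℝ) : Prop :=
  ∀ x y z, k x y = k (x + z) (y + z)

/-- `Λ` is the spectral measure of `k`: `k` is the Fourier transform of `Λ`. -/
def IsSpectralMeasure {d : ℕ} (Λ : Measure (EuclideanSpace ℝ (Fin d)))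
    (k : EuclideanSpace ℝ (Fin d) → EuclideanSpace ℝ (Fin d) → ℝ) : Prop :=
  ∀ x y, (k x y : ℂ) = ∫ w, Complex.exp (Complex.I * ((⟪w, x - y⟫_ℝ : ℝ) : ℂ)) ∂Λ

/-- The Bernstein moment condition with constants `S`, `R` on the coordinates of `w ∼ Λ`:
`𝔼 |w_i|^(2n) ≤ n! S² R^(n-2) / 2` (in particular finite) for all `i` and all `n ≥ 2`. -/
def BernsteinCondition {d : ℕ} (Λ : Measure (EuclideanSpace ℝ (Fin d))) (S R : ℝ) : Prop :=
  ∀ (i : Fin d) (n : ℕ), 2 ≤ n →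
    Integrable (fun w : EuclideanSpace ℝ (Fin d) => |w i| ^ (2 * n)) Λ ∧
      ∫ w, |w i| ^ (2 * n) ∂Λ ≤ (n.factorial : ℝ) * S ^ 2 * R ^ (n - 2) / 2

/-- A sequence `(x_0, …, x_L)` in `X` with `L ≥ 1`. -/
structure PSeq {d : ℕ} (X : Set (EuclideanSpace ℝ (Fin d))) where
  /-- the effective length `L`, i.e. the number of increments -/
  len : ℕ
  one_le_len : 1 ≤ len
  /-- the points `x_0, …, x_L` -/
  pt : Fin (len + 1) → EuclideanSpace ℝ (Fin d)
  mem : ∀ i, pt i ∈ X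

/-- The `1`-variation of a sequence, the sum of the Euclidean norms of its increments. -/
def PSeq.oneVar {d : ℕ} {X : Set (EuclideanSpace ℝ (Fin d))} (x : PSeq X) : ℝ :=
  ∑ i : Fin x.len, ‖x.pt i.succ - x.pt i.castSucc‖

/-- The increment `f(x_{i+1}) - f(x_i)` of a feature map along a sequence. -/
def PSeq.incr {d : ℕ} {X : Set (EuclideanSpace ℝ (Fin d))} {H : Type*} [AddCommGroup H]
    (x : PSeq X) (f : EuclideanSpace ℝ (Fin d) → H) (i : Fin x.len) : H :=
  f (x.pt i.succ) - f (x.pt i.castSucc)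

/-- The second order cross-difference of `k` along the increments `i` of `x` and `j` of `y`. -/
def crossDiff {d : ℕ} {X : Set (EuclideanSpace ℝ (Fin d))}
    (k : EuclideanSpace ℝ (Fin d) → EuclideanSpace ℝ (Fin d) → ℝ) (x y : PSeq X)
    (i : Fin x.len) (j : Fin y.len) : ℝ :=
  k (x.pt i.succ) (y.pt j.succ) - k (x.pt i.succ) (y.pt j.castSucc)
    - k (x.pt i.castSucc) (y.pt j.succ) + k (x.pt i.castSucc) (y.pt j.castSucc)

/-- The level-`m` (discretized, order-1) signature kernel over the static kernel `k`. The strictly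
increasing `m`-tuples of increments are the order embeddings `Fin m ↪o Fin L`. -/
def sigKernel {d : ℕ} {X : Set (EuclideanSpace ℝ (Fin d))}
    (k : EuclideanSpace ℝ (Fin d) → EuclideanSpace ℝ (Fin d) → ℝ) (m : ℕ) (x y : PSeq X) : ℝ :=
  ∑ i : Fin m ↪o Fin x.len, ∑ j : Fin m ↪o Fin y.len, ∏ p : Fin m, crossDiff k x y (i p) (j p)

/-- If `f` is any feature map of `k` (e.g. the RKHS lift), then `sigKernel k m x y` is the inner
product of the tensors `∑_i δf(x_{i_1}) ⊗ ⋯ ⊗ δf(x_{i_m})` and `∑_j δf(y_{j_1}) ⊗ ⋯ ⊗ δf(y_{j_m})`,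
expanded over elementary tensors. -/
theorem sigKernel_eq_of_feature {d : ℕ} {X : Set (EuclideanSpace ℝ (Fin d))} {H : Type*}
    [NormedAddCommGroup H] [InnerProductSpace ℝ H]
    (k : EuclideanSpace ℝ (Fin d) → EuclideanSpace ℝ (Fin d) → ℝ)
    (f : EuclideanSpace ℝ (Fin d) → H) (hf : ∀ x y, k x y = ⟪f x, f y⟫_ℝ) (m : ℕ)
    (x y : PSeq X) :
    sigKernel k m x y = ∑ i : Fin m ↪o Fin x.len, ∑ j : Fin m ↪o Fin y.len,
      ∏ p : Fin m, ⟪x.incr f (i p), y.incr f (j p)⟫_ℝ := by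
  unfold sigKernel
  refine Finset.sum_congr rfl fun i _ => Finset.sum_congr rfl fun j _ =>
    Finset.prod_congr rfl fun p _ => ?_
  simp only [crossDiff, PSeq.incr, hf, inner_sub_left, inner_sub_right]
  ring

/-- The random Fourier feature map `(1/√D) (cos (Wᵀ x), sin (Wᵀ x)) ∈ ℝ^(2D)` with weights
`W = (w_1, …, w_D)`. -/
def rffMap {d D : ℕ} (W : Fin D → EuclideanSpace ℝ (Fin d)) (x : EuclideanSpace ℝ (Fin d)) :
    EuclideanSpace ℝ (Fin D ⊕ Fin D) :=
  WithLp.toLp 2 (Sum.elim (fun j => (1 / √(D : ℝ)) * Real.cos ⟪W j, x⟫_ℝ)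
    (fun j => (1 / √(D : ℝ)) * Real.sin ⟪W j, x⟫_ℝ))

/-- The level-`m` Random Fourier Signature Feature of a sequence, with independent weights
`W 0, …, W (m-1)`: the tensor `∑_i δφ_1(x_{i_1}) ⊗ ⋯ ⊗ δφ_m(x_{i_m})` in `(ℝ^(2D))^{⊗ m}`, written
in coordinates, with the Euclidean inner product. -/
def rfsfMap {d D m : ℕ} {X : Set (EuclideanSpace ℝ (Fin d))}
    (W : Fin m → Fin D → EuclideanSpace ℝ (Fin d)) (x : PSeq X) :
    EuclideanSpace ℝ (Fin m → Fin D ⊕ Fin D) :=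
  WithLp.toLp 2 (fun c => ∑ i : Fin m ↪o Fin x.len, ∏ p : Fin m, x.incr (rffMap (W p)) (i p) (c p))

/-- The level-`m` Random Fourier Signature Feature kernel. -/
def rfsfKernel {d D m : ℕ} {X : Set (EuclideanSpace ℝ (Fin d))}
    (W : Fin m → Fin D → EuclideanSpace ℝ (Fin d)) (x y : PSeq X) : ℝ :=
  ⟪rfsfMap W x, rfsfMap W y⟫_ℝ

/-- The random Fourier feature kernel `(1/D) ∑_j cos (w_jᵀ (x - y))`. -/
def rffKernel {d D : ℕ} (W : Fin D → EuclideanSpace ℝ (Fin d))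
    (x y : EuclideanSpace ℝ (Fin d)) : ℝ :=
  (1 / (D : ℝ)) * ∑ j, Real.cos ⟪W j, x - y⟫_ℝ

theorem rffKernel_eq_inner {d D : ℕ} (W : Fin D → EuclideanSpace ℝ (Fin d))
    (x y : EuclideanSpace ℝ (Fin d)) :
    rffKernel W x y = ⟪rffMap W x, rffMap W y⟫_ℝ := by
  have h : (√(D : ℝ))⁻¹ * (√(D : ℝ))⁻¹ = (D : ℝ)⁻¹ := by
    rw [← mul_inv, Real.mul_self_sqrt (Nat.cast_nonneg D)]
  simp only [rffKernel, rffMap, PiLp.inner_apply, Fintype.sum_sum_type, Sum.elim_inl,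
    Sum.elim_inr, ← Finset.sum_add_distrib, Finset.mul_sum, inner_sub_right, Real.cos_sub,
    one_div]
  refine Finset.sum_congr rfl fun j _ => ?_
  simp only [RCLike.inner_apply, conj_trivial]
  rw [← h]
  ring

/-- The kernel trick for the Random Fourier Signature Feature kernel. -/
theorem rfsfKernel_eq_sum {d D m : ℕ} {X : Set (EuclideanSpace ℝ (Fin d))}
    (W : Fin m → Fin D → EuclideanSpace ℝ (Fin d)) (x y : PSeq X) :
    rfsfKernel W x y = ∑ i : Fin m ↪o Fin x.len, ∑ j : Fin m ↪o Fin y.len,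
      ∏ p : Fin m, crossDiff (rffKernel (W p)) x y (i p) (j p) := by
  have hc : ∀ (p : Fin m) (i : Fin x.len) (j : Fin y.len),
      crossDiff (rffKernel (W p)) x y i j
        = ∑ c, y.incr (rffMap (W p)) j c * x.incr (rffMap (W p)) i c := by
    intro p i j
    have : crossDiff (rffKernel (W p)) x y i j
        = ⟪x.incr (rffMap (W p)) i, y.incr (rffMap (W p)) j⟫_ℝ := by
      simp only [crossDiff, PSeq.incr, rffKernel_eq_inner, inner_sub_left, inner_sub_right]
      ring
    rw [this, PiLp.inner_apply]
    simp only [RCLike.inner_apply, conj_trivial]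
  simp only [hc, Finset.prod_univ_sum, Fintype.piFinset_univ, Finset.prod_mul_distrib]
  simp only [rfsfKernel, rfsfMap, PiLp.inner_apply, RCLike.inner_apply, conj_trivial,
    Finset.sum_mul_sum]
  exact (Finset.sum_comm.trans (Finset.sum_congr rfl fun _ _ => Finset.sum_comm)).trans
    Finset.sum_comm

/-- `σ_Λ² = 𝔼 ‖w‖²`. -/
def sigmaSq {d : ℕ} (Λ : Measure (EuclideanSpace ℝ (Fin d))) : ℝ := ∫ w, ‖w‖ ^ 2 ∂Λ

/-- The second moment matrix `𝔼 [w wᵀ]`. -/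
def secondMoment {d : ℕ} (Λ : Measure (EuclideanSpace ℝ (Fin d))) : Matrix (Fin d) (Fin d) ℝ :=
  Matrix.of fun i j => ∫ w, w i * w j ∂Λ

/-- `L = ‖𝔼 [w wᵀ]‖₂^(1/2)`, with the spectral norm. -/
def lipConst {d : ℕ} (Λ : Measure (EuclideanSpace ℝ (Fin d))) : ℝ :=
  √‖Matrix.toEuclideanCLM (n := Fin d) (𝕜 := ℝ) (secondMoment Λ)‖

/-- `E_{i,j} = 𝔼 [|w_i w_j| ‖w‖]`. -/
def Emom {d : ℕ} (Λ : Measure (EuclideanSpace ℝ (Fin d))) (i j : Fin d) : ℝ :=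
  ∫ w, |w i * w j| * ‖w‖ ∂Λ

/-- The function `z ↦ k(z)` with `k x y = k (x - y)`, for a translation-invariant `k`. -/
def profile {d : ℕ} (k : EuclideanSpace ℝ (Fin d) → EuclideanSpace ℝ (Fin d) → ℝ)
    (z : EuclideanSpace ℝ (Fin d)) : ℝ := k z 0

/-- The partial derivative `∂f/∂z_i`. -/
def partialDeriv {d : ℕ} (i : Fin d) (f : EuclideanSpace ℝ (Fin d) → ℝ)
    (z : EuclideanSpace ℝ (Fin d)) : ℝ := fderiv ℝ f z (EuclideanSpace.single i 1)

/-- The difference set `X_Δ = {x - y : x, y ∈ X}`. -/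
def diffSet {d : ℕ} (X : Set (EuclideanSpace ℝ (Fin d))) : Set (EuclideanSpace ℝ (Fin d)) :=
  {z | ∃ x ∈ X, ∃ y ∈ X, z = x - y}

/-- The values `‖∇[∂²k/∂z_i∂z_j](z)‖` over `z ∈ X_Δ`. -/
def gradNorms {d : ℕ} (k : EuclideanSpace ℝ (Fin d) → EuclideanSpace ℝ (Fin d) → ℝ)
    (X : Set (EuclideanSpace ℝ (Fin d))) (i j : Fin d) : Set ℝ :=
  (fun z => ‖gradient (partialDeriv i (partialDeriv j (profile k))) z‖) '' diffSet X

/-- `D_{i,j} = sup_{z ∈ X_Δ} ‖∇[∂²k/∂z_i∂z_j](z)‖`. -/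
def Dsup {d : ℕ} (k : EuclideanSpace ℝ (Fin d) → EuclideanSpace ℝ (Fin d) → ℝ)
    (X : Set (EuclideanSpace ℝ (Fin d))) (i j : Fin d) : ℝ := sSup (gradNorms k X i j)

/-- `C_{d,X} = 2^(1/(d+1)) · 16 · |X|^(d/(d+1)) · ∑_{i,j} (D_{i,j} + E_{i,j})^(d/(d+1))`. -/
def Cconst {d : ℕ} (k : EuclideanSpace ℝ (Fin d) → EuclideanSpace ℝ (Fin d) → ℝ)
    (Λ : Measure (EuclideanSpace ℝ (Fin d))) (X : Set (EuclideanSpace ℝ (Fin d))) : ℝ :=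
  (2 : ℝ) ^ ((1 : ℝ) / (d + 1)) * 16 * Metric.diam X ^ ((d : ℝ) / (d + 1)) *
    ∑ i : Fin d, ∑ j : Fin d, (Dsup k X i j + Emom Λ i j) ^ ((d : ℝ) / (d + 1))

/-- `β_{d,m,V} = m (2 V² (L² ∨ 1) (σ_Λ² ∨ d))^m`. -/
def betaConst {d : ℕ} (Λ : Measure (EuclideanSpace ℝ (Fin d))) (m : ℕ) (V : ℝ) : ℝ :=
  m * (2 * V ^ 2 * max (lipConst Λ ^ 2) 1 * max (sigmaSq Λ) d) ^ m

/-- The additive constant in the prefactor: `d`, except that it is `2` for `d = m = 1`. -/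
def addConst (d m : ℕ) : ℝ := if d = 1 ∧ m = 1 then 2 else d

/-- The tail bound, with RFF dimension `D`. -/
def tailBound {d : ℕ} (k : EuclideanSpace ℝ (Fin d) → EuclideanSpace ℝ (Fin d) → ℝ)
    (Λ : Measure (EuclideanSpace ℝ (Fin d))) (X : Set (EuclideanSpace ℝ (Fin d)))
    (S R : ℝ) (D m : ℕ) (V ε : ℝ) : ℝ :=
  m * if ε < betaConst Λ m V then
      (Cconst k Λ X * (betaConst Λ m V / ε) ^ ((d : ℝ) / (d + 1)) + addConst d m) *
        Real.exp (-((D : ℝ) / (2 * (d + 1) * (S ^ 2 + R))) * (ε / betaConst Λ m V) ^ 2)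
    else
      (Cconst k Λ X * (betaConst Λ m V / ε) ^ ((d : ℝ) / ((d + 1) * m)) + addConst d m) *
        Real.exp (-((D : ℝ) / (2 * (d + 1) * (S ^ 2 + R))) *
          (ε / betaConst Λ m V) ^ ((1 : ℝ) / m))

/-- `sup |k_m(x, y) - k̃_m(x, y)|` over all sequences in `X` with `1`-variation at most `V`, as an
extended nonnegative real. -/
def uniformError {d D m : ℕ} (k : EuclideanSpace ℝ (Fin d) → EuclideanSpace ℝ (Fin d) → ℝ)
    (X : Set (EuclideanSpace ℝ (Fin d))) (V : ℝ)
    (W : Fin m → Fin D → EuclideanSpace ℝ (Fin d)) : ℝ≥0∞ :=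
  ⨆ (x : PSeq X) (y : PSeq X) (_ : x.oneVar ≤ V) (_ : y.oneVar ≤ V),
    ENNReal.ofReal |sigKernel k m x y - rfsfKernel W x y|

end RFSF

end

/-! Both `k` and each random Fourier feature kernel are cosine transforms, of `Λ` and of the
empirical measure of the weights respectively. Applying the mean value theorem once in each variable
turns a cross-difference into a second derivative at a point of `X_Δ`, evaluated on the two
increments (`exists_crossDiff_eq`). A bound `t` on all entries of the Hessian error over `X_Δ`
therefore bounds the error of a cross-difference by `d t ‖δx‖ ‖δy‖`. The cross-differences
themselves are at most `K ‖δx‖ ‖δy‖`, where `K` dominates `L²` and the empirical second moments.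
Telescoping the products, and bounding each sum over increasing tuples by `V^m / m!`, gives the
deterministic estimate `m d t K^(m-1) (V^m / m!)²` (`abs_sigKernel_sub_le`).

Choose `η`, `τ` with `η τ^(m-1) β = ε`. The error is below `ε` once every Hessian error is uniformly
below `2 η (m!)²` and, for `m ≥ 2`, every empirical second moment is below `σ² + d τ`
(`uniformError_lt`). The two regimes of the theorem are `τ = 1` and `τ = η`.

The Hessian error is handled by Bernstein's inequality on a finite net of `X_Δ` together with
Markov's inequality for the random Lipschitz constant; balancing the radius replaces the Bernstein
exponential by its `(d+1)`-th root `q` (`measureReal_hessError_le`). The second moments obey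
Bernstein coordinatewise. The terms left over are higher powers of `q`, hence fit into the additive
constant whenever the claimed bound is below 1 (`absorb_le`). -/

namespace RFSF

/-! ### Bernstein's inequality from raw moment bounds -/

section Bernstein

variable {α Ω : Type*} [MeasurableSpace α] [MeasurableSpace Ω]

/-- The Bernstein moment condition for a real function on a probability space. -/
structure BernsteinMoments (μ : Measure α) (f : α → ℝ) (S R : ℝ) : Prop where
  meas : AEMeasurable f μ
  integrable : ∀ n : ℕ, 2 ≤ n → Integrable (fun a => |f a| ^ n) μ
  le : ∀ n : ℕ, 2 ≤ n → ∫ a, |f a| ^ n ∂μ ≤ n.factorial * S ^ 2 * R ^ (n - 2) / 2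

namespace BernsteinMoments

variable {μ : Measure α} {f : α → ℝ} {S R : ℝ}

theorem integrable_pow [IsProbabilityMeasure μ] (h : BernsteinMoments μ f S R) (n : ℕ) :
    Integrable (fun a => |f a| ^ n) μ := by
  by_cases hn : 2 ≤ n
  · exact h.integrable n hn
  · refine ((integrable_const (1 : ℝ)).add (h.integrable 2 le_rfl)).mono'
      ((h.meas.abs.pow_const n).aestronglyMeasurable) (Filter.Eventually.of_forall fun a => ?_)
    have h0 : 0 ≤ |f a| := abs_nonneg _
    rw [Real.norm_of_nonneg (by positivity)]
    interval_cases n <;> simp <;> nlinarith [sq_abs (f a), sq_nonneg (|f a| - 1)]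

theorem neg (h : BernsteinMoments μ f S R) : BernsteinMoments μ (fun a => -f a) S R :=
  ⟨h.meas.neg, by simpa using h.integrable, by simpa using h.le⟩

theorem hasSum_bound {l : ℝ} (hl : 0 ≤ l) (hlR : l * R < 1) (hR : 0 < R) :
    HasSum (fun n => l ^ (n + 2) * S ^ 2 * R ^ n / 2)
      (l ^ 2 * S ^ 2 / (2 * (1 - l * R))) := by
  have := (hasSum_geometric_of_lt_one (by positivity : 0 ≤ l * R) hlR).mul_left (l ^ 2 * S ^ 2 / 2)
  convert! this using 1
  · ext n; rw [mul_pow]; ring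
  · have : 1 - l * R ≠ 0 := by linarith
    field_simp

theorem term_le [IsProbabilityMeasure μ] (h : BernsteinMoments μ f S R) {l : ℝ} (hl : 0 ≤ l)
    (n : ℕ) :
    ∫ a, (l * |f a|) ^ (n + 2) / (n + 2).factorial ∂μ ≤ l ^ (n + 2) * S ^ 2 * R ^ n / 2 := by
  have h1 := h.le (n + 2) (by omega)
  have h2 : ∫ a, (l * |f a|) ^ (n + 2) / (n + 2).factorial ∂μ
      = l ^ (n + 2) / (n + 2).factorial * ∫ a, |f a| ^ (n + 2) ∂μ := by
    rw [← integral_const_mul]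
    congr 1; ext a; rw [mul_pow]; ring
  rw [h2]
  calc _ ≤ l ^ (n + 2) / (n + 2).factorial *
        ((n + 2).factorial * S ^ 2 * R ^ (n + 2 - 2) / 2) := by gcongr
    _ = _ := by
        have : ((n + 2).factorial : ℝ) ≠ 0 := by positivity
        rw [Nat.add_sub_cancel]
        field_simp

theorem summable_integral [IsProbabilityMeasure μ] (h : BernsteinMoments μ f S R) {l : ℝ}
    (hl : 0 ≤ l) (hlR : l * R < 1) (hR : 0 < R) :
    Summable fun n : ℕ => ∫ a, (l * |f a|) ^ n / n.factorial ∂μ := by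
  rw [← summable_nat_add_iff 2]
  exact Summable.of_nonneg_of_le (fun n => integral_nonneg fun a => by positivity)
    (fun n => h.term_le hl n) (hasSum_bound hl hlR hR).summable

/-- By Tonelli the exponential series is integrated termwise; from order two on, its terms are
dominated by a convergent geometric series. -/
theorem integrable_exp_abs [IsProbabilityMeasure μ] (h : BernsteinMoments μ f S R) {l : ℝ}
    (hl : 0 ≤ l) (hlR : l * R < 1) (hR : 0 < R) :
    Integrable (fun a => Real.exp (l * |f a|)) μ := by
  have hmeas : AEMeasurable (fun a => Real.exp (l * |f a|)) μ :=
    (h.meas.abs.const_mul l).exp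
  have hint : ∀ n : ℕ, Integrable (fun a => (l * |f a|) ^ n / n.factorial) μ := fun n => by
    simp_rw [mul_pow]
    exact ((h.integrable_pow n).const_mul _).div_const _
  refine ⟨hmeas.aestronglyMeasurable, ?_⟩
  rw [hasFiniteIntegral_iff_ofReal (Filter.Eventually.of_forall fun a => (Real.exp_pos _).le)]
  have h1 : ∀ a, ENNReal.ofReal (Real.exp (l * |f a|))
      = ∑' n : ℕ, ENNReal.ofReal ((l * |f a|) ^ n / n.factorial) := fun a => by
    rw [Real.exp_eq_exp_ℝ, NormedSpace.exp_eq_tsum_div,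
      ENNReal.ofReal_tsum_of_nonneg (fun n => by positivity) (Real.summable_pow_div_factorial _)]
  simp_rw [h1]
  rw [lintegral_tsum fun n => (hint n).aestronglyMeasurable.aemeasurable.ennreal_ofReal]
  have h2 : ∀ n : ℕ, ∫⁻ a, ENNReal.ofReal ((l * |f a|) ^ n / n.factorial) ∂μ
      = ENNReal.ofReal (∫ a, (l * |f a|) ^ n / n.factorial ∂μ) := fun n =>
    (ofReal_integral_eq_lintegral_ofReal (hint n)
      (Filter.Eventually.of_forall fun a => by positivity)).symm
  simp_rw [h2]
  rw [← ENNReal.ofReal_tsum_of_nonneg (fun n => integral_nonneg fun a => by positivity)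
    (h.summable_integral hl hlR hR)]
  exact ENNReal.ofReal_lt_top

theorem integrable_exp [IsProbabilityMeasure μ] (h : BernsteinMoments μ f S R) {l : ℝ}
    (hl : 0 ≤ l) (hlR : l * R < 1) (hR : 0 < R) :
    Integrable (fun a => Real.exp (l * f a)) μ := by
  refine (h.integrable_exp_abs hl hlR hR).mono' (h.meas.const_mul l).exp.aestronglyMeasurable
    (Filter.Eventually.of_forall fun a => ?_)
  rw [Real.norm_of_nonneg (Real.exp_pos _).le]
  gcongr
  exact le_abs_self _

/-- The Bernstein bound on the moment generating function. -/
theorem mgf_le [IsProbabilityMeasure μ] (h : BernsteinMoments μ f S R) {l : ℝ}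
    (hl : 0 ≤ l) (hlR : l * R < 1) (hR : 0 < R) :
    mgf f μ l ≤ Real.exp (l * ∫ a, f a ∂μ + l ^ 2 * S ^ 2 / (2 * (1 - l * R))) := by
  have hint : ∀ n : ℕ, Integrable (fun a => (l * f a) ^ n / n.factorial) μ := fun n => by
    simp_rw [mul_pow]
    refine (Integrable.const_mul ?_ _).div_const _
    exact (h.integrable_pow n).mono' (h.meas.pow_const n).aestronglyMeasurable
      (Filter.Eventually.of_forall fun a => by simp)
  have habs : ∀ (n : ℕ) a, ‖(l * f a) ^ n / n.factorial‖ = (l * |f a|) ^ n / n.factorial := by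
    intro n a
    rw [norm_div, norm_pow, norm_mul, Real.norm_of_nonneg hl, Real.norm_eq_abs (f a)]
    simp
  have hsum : Summable fun n : ℕ => ∫ a, ‖(l * f a) ^ n / (n.factorial : ℝ)‖ ∂μ := by
    simp_rw [habs]
    exact h.summable_integral hl hlR hR
  have hs := hasSum_integral_of_summable_integral_norm hint hsum
  have hexp : ∫ a, ∑' n : ℕ, (l * f a) ^ n / (n.factorial : ℝ) ∂μ = mgf f μ l := by
    simp only [mgf, Real.exp_eq_exp_ℝ, NormedSpace.exp_eq_tsum_div]
  rw [hexp] at hs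
  -- Orders 0 and 1 contribute exactly `1 + l ∫ f`, the remaining orders lie below the geometric
  -- series, and `1 + x ≤ exp x` concludes. Raw moments suffice; no centring is needed.
  have h2 := (hasSum_nat_add_iff' 2).2 hs
  have hle := hasSum_le (fun n => ?_) h2 (hasSum_bound (S := S) hl hlR hR)
  · simp only [Finset.sum_range_succ, Finset.sum_range_zero, zero_add, pow_zero, pow_one,
      Nat.factorial_zero, Nat.factorial_one, Nat.cast_one, div_one, integral_const,
      probReal_univ, smul_eq_mul, mul_one, integral_const_mul] at hle
    have := Real.add_one_le_exp (l * ∫ a, f a ∂μ + l ^ 2 * S ^ 2 / (2 * (1 - l * R)))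
    linarith
  · refine le_trans ?_ (h.term_le hl n)
    refine (le_abs_self _).trans ?_
    rw [← Real.norm_eq_abs]
    refine (norm_integral_le_integral_norm _).trans (le_of_eq ?_)
    simp_rw [habs]

end BernsteinMoments

/-- Bernstein's inequality for independent functions of variables with a common law. -/
theorem bernstein {D : ℕ} {μ : Measure α} [IsProbabilityMeasure μ] {f : α → ℝ} {S R : ℝ}
    (h : BernsteinMoments μ f S R) (hf : Measurable f) (hS : 0 < S) (hR : 0 < R)
    {P : Measure Ω} [IsProbabilityMeasure P] {W : Fin D → Ω → α}
    (hW : ∀ j, HasLaw (W j) μ P) (hind : iIndepFun W P) (hD : 1 ≤ D) {t : ℝ} (ht : 0 ≤ t) :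
    P.real {ω | (∫ a, f a ∂μ) + t ≤ (1 / (D : ℝ)) * ∑ j, f (W j ω)} ≤
      Real.exp (-(D * t ^ 2 / (2 * (S ^ 2 + R * t)))) := by
  have hD0 : (0 : ℝ) < D := by exact_mod_cast hD
  -- With this `l` the exponent per variable, `-l t + l² S² / (2 (1 - l R))`, collapses to `-t² / (2
  -- (S² + R t))`.
  set l := t / (S ^ 2 + R * t) with hldef
  have hden : 0 < S ^ 2 + R * t := by positivity
  have hl : 0 ≤ l := by positivity
  have hlR1 : 1 - l * R = S ^ 2 / (S ^ 2 + R * t) := by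
    rw [hldef]; field_simp; ring
  have hlR : l * R < 1 := by
    have : 0 < S ^ 2 / (S ^ 2 + R * t) := by positivity
    linarith
  set Y : Fin D → Ω → ℝ := fun j ω => f (W j ω) with hY
  have hYm : ∀ j, AEMeasurable (Y j) P := fun j => hf.comp_aemeasurable (hW j).aemeasurable
  have hYind : iIndepFun Y P := hind.comp (fun _ => f) fun _ => hf
  have hYint : ∀ j, Integrable (fun ω => Real.exp (l * Y j ω)) P := fun j => by
    have := h.integrable_exp hl hlR hR
    rw [← (hW j).map_eq] at this
    exact this.comp_aemeasurable (hW j).aemeasurable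
  have hYmgf : ∀ j, mgf (Y j) P l = mgf f μ l := fun j => by
    simp only [mgf, hY]
    rw [← (hW j).map_eq, integral_map (hW j).aemeasurable]
    exact (hf.const_mul l).exp.aestronglyMeasurable
  have hsumint : Integrable (fun ω => Real.exp (l * (∑ j, Y j) ω)) P := by
    -- `HasLaw` provides only a.e. measurability, so the sum is treated through measurable
    -- modifications.
    set Z : Fin D → Ω → ℝ := fun j => (hYm j).mk
    have hYZ : ∀ j, Y j =ᵐ[P] Z j := fun j => (hYm j).ae_eq_mk
    have hZ := (hYind.congr hYZ).integrable_exp_mul_sum (t := l)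
      (fun j => (hYm j).measurable_mk) (s := Finset.univ) fun j _ =>
        (hYint j).congr ((hYZ j).fun_comp fun x => Real.exp (l * x))
    refine hZ.congr ?_
    filter_upwards [ae_all_iff.2 hYZ] with ω hω
    simp [Finset.sum_apply, hω]
  have hmain := measure_ge_le_exp_mul_mgf (X := ∑ j, Y j) (D * ((∫ a, f a ∂μ) + t)) hl hsumint
  rw [hYind.mgf_sum₀ hYm] at hmain
  simp only [hYmgf, Finset.prod_const, Finset.card_univ, Fintype.card_fin] at hmain
  have hset : {ω | (∫ a, f a ∂μ) + t ≤ (1 / (D : ℝ)) * ∑ j, f (W j ω)}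
      = {ω | D * ((∫ a, f a ∂μ) + t) ≤ (∑ j, Y j) ω} := by
    ext ω
    simp only [Set.mem_ofPred_eq, Finset.sum_apply, hY]
    rw [one_div, inv_mul_eq_div, le_div_iff₀ hD0, mul_comm]
  rw [hset]
  refine hmain.trans ?_
  calc _ ≤ Real.exp (-l * (D * ((∫ a, f a ∂μ) + t))) *
        Real.exp (l * ∫ a, f a ∂μ + l ^ 2 * S ^ 2 / (2 * (1 - l * R))) ^ D := by
        gcongr
        · exact mgf_nonneg
        · exact h.mgf_le hl hlR hR
    _ = _ := by
        rw [← Real.exp_nat_mul, ← Real.exp_add, hlR1]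
        congr 1
        rw [hldef]
        field_simp
        ring

end Bernstein

/-! ### Cosine transforms and their derivatives -/

section CosInt

variable {d : ℕ}

/-- The cosine transform `z ↦ ∫ a(w) cos(⟪w, z⟫ + c) dμ(w)` of the density `a`. -/
noncomputable def cosInt (μ : Measure (EuclideanSpace ℝ (Fin d))) (a : EuclideanSpace ℝ (Fin d) → ℝ) (c : ℝ)
    (z : EuclideanSpace ℝ (Fin d)) : ℝ :=
  ∫ w, a w * Real.cos (⟪w, z⟫_ℝ + c) ∂μ

variable {μ : Measure (EuclideanSpace ℝ (Fin d))} {a : EuclideanSpace ℝ (Fin d) → ℝ}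

theorem integrable_mul_cos (ha : Integrable a μ) (c : ℝ) (z : EuclideanSpace ℝ (Fin d)) :
    Integrable (fun w => a w * Real.cos (⟪w, z⟫_ℝ + c)) μ := by
  refine ha.mul_bdd (c := 1) (by fun_prop) (Filter.Eventually.of_forall fun w => ?_)
  rw [Real.norm_eq_abs]
  exact Real.abs_cos_le_one _

theorem aestronglyMeasurable_fderiv (ha : Integrable a μ) (c : ℝ)
    (z : EuclideanSpace ℝ (Fin d)) :
    AEStronglyMeasurable
      (fun w => (a w * Real.cos (⟪w, z⟫_ℝ + c + Real.pi / 2)) • innerSL ℝ w) μ := by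
  have h1 : AEStronglyMeasurable
      (fun w => a w * Real.cos (⟪w, z⟫_ℝ + c + Real.pi / 2)) μ := by
    simpa only [add_assoc] using
      (integrable_mul_cos ha (c + Real.pi / 2) z).aestronglyMeasurable
  exact h1.smul (innerSL ℝ (E := EuclideanSpace ℝ (Fin d))).continuous.aestronglyMeasurable

theorem norm_fderiv_integrand_le (a : EuclideanSpace ℝ (Fin d) → ℝ) (c : ℝ)
    (z w : EuclideanSpace ℝ (Fin d)) :
    ‖(a w * Real.cos (⟪w, z⟫_ℝ + c + Real.pi / 2)) • innerSL ℝ w‖ ≤ |a w| * ‖w‖ := by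
  rw [norm_smul, norm_mul, Real.norm_eq_abs, innerSL_apply_norm, Real.norm_eq_abs]
  gcongr
  exact mul_le_of_le_one_right (abs_nonneg _) (Real.abs_cos_le_one _)

/-- Differentiation under the integral, dominated by `|a w| ‖w‖`. Writing `-sin` as `cos (· + π/2)`
keeps derivatives inside the family `cosInt`: each one multiplies the density by a linear form and
adds `π/2` to the phase, so second derivatives carry the phase `π`. -/
theorem hasFDerivAt_cosInt (ha : Integrable a μ) (ha1 : Integrable (fun w => |a w| * ‖w‖) μ)
    (c : ℝ) (z : EuclideanSpace ℝ (Fin d)) :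
    HasFDerivAt (cosInt μ a c)
      (∫ w, (a w * Real.cos (⟪w, z⟫_ℝ + c + Real.pi / 2)) • innerSL ℝ w ∂μ) z := by
  refine hasFDerivAt_integral_of_dominated_of_fderiv_le (s := Set.univ)
    (F := fun z w => a w * Real.cos (⟪w, z⟫_ℝ + c))
    (F' := fun z w => (a w * Real.cos (⟪w, z⟫_ℝ + c + Real.pi / 2)) • innerSL ℝ w)
    (bound := fun w => |a w| * ‖w‖) Filter.univ_mem
    (Filter.Eventually.of_forall fun z => (integrable_mul_cos ha c z).aestronglyMeasurable)
    (integrable_mul_cos ha c z) (aestronglyMeasurable_fderiv ha c z)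
    (Filter.Eventually.of_forall fun w z _ => norm_fderiv_integrand_le a c z w) ha1 ?_
  · refine Filter.Eventually.of_forall fun w z _ => ?_
    have h1 : HasFDerivAt (fun z : EuclideanSpace ℝ (Fin d) => ⟪w, z⟫_ℝ + c) (innerSL ℝ w) z :=
      ((innerSL ℝ w).hasFDerivAt).add_const c
    have h2 := (h1.cos).const_mul (a w)
    convert! h2 using 1
    rw [Real.cos_add_pi_div_two, smul_smul]

theorem integral_fderiv_apply (ha : Integrable a μ)
    (ha1 : Integrable (fun w => |a w| * ‖w‖) μ) (c : ℝ) (z v : EuclideanSpace ℝ (Fin d)) :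
    (∫ w, (a w * Real.cos (⟪w, z⟫_ℝ + c + Real.pi / 2)) • innerSL ℝ w ∂μ) v
      = cosInt μ (fun w => a w * ⟪w, v⟫_ℝ) (c + Real.pi / 2) z := by
  rw [ContinuousLinearMap.integral_apply]
  · simp only [cosInt, _root_.smul_apply, smul_eq_mul, innerSL_apply_apply]
    congr 1; ext w; rw [add_assoc]; ring
  · exact ha1.mono' (aestronglyMeasurable_fderiv ha c z)
      (Filter.Eventually.of_forall (norm_fderiv_integrand_le a c z))

theorem norm_fderiv_cosInt_le (ha : Integrable a μ) (ha1 : Integrable (fun w => |a w| * ‖w‖) μ)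
    (c : ℝ) (z : EuclideanSpace ℝ (Fin d)) :
    ‖fderiv ℝ (cosInt μ a c) z‖ ≤ ∫ w, |a w| * ‖w‖ ∂μ := by
  rw [(hasFDerivAt_cosInt ha ha1 c z).fderiv]
  refine norm_integral_le_of_norm_le ha1 
    (Filter.Eventually.of_forall (norm_fderiv_integrand_le a c z))

theorem abs_cosInt_sub_le (ha : Integrable a μ) (ha1 : Integrable (fun w => |a w| * ‖w‖) μ)
    (c : ℝ) {B : ℝ} {s : Set (EuclideanSpace ℝ (Fin d))} (hs : Convex ℝ s)
    (hB : ∀ z ∈ s, ‖fderiv ℝ (cosInt μ a c) z‖ ≤ B) {z z' : EuclideanSpace ℝ (Fin d)}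
    (hz : z ∈ s) (hz' : z' ∈ s) :
    |cosInt μ a c z - cosInt μ a c z'| ≤ B * ‖z - z'‖ := by
  rw [← Real.norm_eq_abs]
  exact hs.norm_image_sub_le_of_norm_fderiv_le
    (fun x _ => (hasFDerivAt_cosInt ha ha1 c x).differentiableAt) hB hz' hz

theorem partialDeriv_cosInt (ha : Integrable a μ) (ha1 : Integrable (fun w => |a w| * ‖w‖) μ)
    (c : ℝ) (i : Fin d) :
    partialDeriv i (cosInt μ a c) = cosInt μ (fun w => a w * w i) (c + Real.pi / 2) := by
  ext z
  rw [partialDeriv, (hasFDerivAt_cosInt ha ha1 c z).fderiv, integral_fderiv_apply ha ha1]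
  congr 1; ext w
  simp [EuclideanSpace.inner_single_right]

theorem hasDerivAt_cosInt_line (ha : Integrable a μ)
    (ha1 : Integrable (fun w => |a w| * ‖w‖) μ) (c : ℝ) (z v : EuclideanSpace ℝ (Fin d)) (t : ℝ) :
    HasDerivAt (fun s : ℝ => cosInt μ a c (z + s • v))
      (cosInt μ (fun w => a w * ⟪w, v⟫_ℝ) (c + Real.pi / 2) (z + t • v)) t := by
  rw [← integral_fderiv_apply ha ha1]
  have h1 : HasDerivAt (fun s : ℝ => z + s • v) v t := by
    simpa using ((hasDerivAt_id t).smul_const v).const_add z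
  exact (hasFDerivAt_cosInt ha ha1 c (z + t • v)).comp_hasDerivAt t h1

/-- A measurable function of polynomial growth is integrable if the corresponding moment is
finite. -/
theorem integrable_of_le_norm_pow [IsFiniteMeasure μ] {N n : ℕ} (h : MemLp id (N : ℝ≥0∞) μ)
    (hn : n ≤ N) (ha : Measurable a) {C : ℝ} (hC : ∀ w, |a w| ≤ C * ‖w‖ ^ n) : Integrable a μ := by
  have h1 : Integrable (fun w : EuclideanSpace ℝ (Fin d) => ‖w‖ ^ n) μ := by
    have := (h.mono_exponent (p := (n : ℝ≥0∞)) (by exact_mod_cast hn)).integrable_norm_pow'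
    simpa using this
  exact (h1.const_mul C).mono' ha.aestronglyMeasurable (Filter.Eventually.of_forall hC)

theorem abs_coord_le (w : EuclideanSpace ℝ (Fin d)) (i : Fin d) : |w i| ≤ ‖w‖ := by
  simpa using PiLp.norm_apply_le w i

theorem abs_cosInt_le (a : EuclideanSpace ℝ (Fin d) → ℝ) (ha : Integrable a μ) (c : ℝ)
    (z : EuclideanSpace ℝ (Fin d)) : |cosInt μ a c z| ≤ ∫ w, |a w| ∂μ := by
  rw [← Real.norm_eq_abs]
  refine norm_integral_le_of_norm_le ha.abs (Filter.Eventually.of_forall fun w => ?_)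
  rw [norm_mul, Real.norm_eq_abs, Real.norm_eq_abs]
  exact mul_le_of_le_one_right (abs_nonneg _) (Real.abs_cos_le_one _)

end CosInt

/-! ### Cross-differences as second derivatives -/

section CrossDiff

variable {d : ℕ} {X : Set (EuclideanSpace ℝ (Fin d))}

/-- The mean value theorem for the second order cross-difference of a translation-invariant
kernel. -/
theorem exists_crossDiff_eq (hX : Convex ℝ X) {h : EuclideanSpace ℝ (Fin d) → ℝ}
    {h' : EuclideanSpace ℝ (Fin d) → EuclideanSpace ℝ (Fin d) → ℝ}
    {h'' : EuclideanSpace ℝ (Fin d) → EuclideanSpace ℝ (Fin d) → EuclideanSpace ℝ (Fin d) → ℝ}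
    (H1 : ∀ z v t, HasDerivAt (fun s : ℝ => h (z + s • v)) (h' v (z + t • v)) t)
    (H2 : ∀ z v u t, HasDerivAt (fun s : ℝ => h' v (z + s • u)) (h'' v u (z + t • u)) t)
    (x y : PSeq X) (i : Fin x.len) (j : Fin y.len) :
    ∃ z ∈ diffSet X, crossDiff (fun x y => h (x - y)) x y i j
      = h'' (x.pt i.succ - x.pt i.castSucc) (-(y.pt j.succ - y.pt j.castSucc)) z := by
  set x0 := x.pt i.castSucc
  set x1 := x.pt i.succ
  set y0 := y.pt j.castSucc
  set y1 := y.pt j.succ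
  set v := x1 - x0 with hv
  set u := -(y1 - y0) with hu
  -- The increment of this function over `[0, 1]` is the cross-difference. The mean value theorem is
  -- applied to it in the first variable, then to the resulting derivative in the second.
  have hF : ∀ s : ℝ, HasDerivAt (fun s : ℝ => h (x0 - y1 + s • v) - h (x0 - y0 + s • v))
      (h' v (x0 - y1 + s • v) - h' v (x0 - y0 + s • v)) s := fun s => (H1 _ _ s).sub (H1 _ _ s)
  obtain ⟨s, hs, hs'⟩ := exists_hasDerivAt_eq_slope _ _ zero_lt_one
    (fun s _ => (hF s).continuousAt.continuousWithinAt) fun s _ => hF s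
  have hG : ∀ t : ℝ, HasDerivAt (fun t : ℝ => h' v (x0 - y0 + s • v + t • u))
      (h'' v u (x0 - y0 + s • v + t • u)) t := fun t => H2 _ _ _ t
  obtain ⟨t, ht, ht'⟩ := exists_hasDerivAt_eq_slope _ _ zero_lt_one
    (fun t _ => (hG t).continuousAt.continuousWithinAt) fun t _ => hG t
  -- The intermediate point is a difference of points on the two segments, so convexity puts it in
  -- `X_Δ`. The sign in `u` is there because `y` enters through `x - y`.
  refine ⟨x0 - y0 + s • v + t • u, ⟨x0 + s • (x1 - x0), ?_, y0 + t • (y1 - y0), ?_, ?_⟩, ?_⟩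
  · exact hX.add_smul_sub_mem (x.mem _) (x.mem _) ⟨hs.1.le, hs.2.le⟩
  · exact hX.add_smul_sub_mem (y.mem _) (y.mem _) ⟨ht.1.le, ht.2.le⟩
  · rw [hv, hu, smul_neg]; abel
  · rw [ht']
    have e1 : x0 - y0 + s • v + (1 : ℝ) • u = x0 - y1 + s • v := by rw [hu, one_smul]; abel
    have e2 : x0 - y0 + s • v + (0 : ℝ) • u = x0 - y0 + s • v := by rw [zero_smul, add_zero]
    have e3 : x0 - y1 + (1 : ℝ) • v = x1 - y1 := by rw [hv, one_smul]; abel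
    have e4 : x0 - y0 + (1 : ℝ) • v = x1 - y0 := by rw [hv, one_smul]; abel
    rw [e1, e2, hs', e3, e4]
    simp only [zero_smul, add_zero, crossDiff]
    simp only [x0, x1, y0, y1]
    ring

variable {μ ν : Measure (EuclideanSpace ℝ (Fin d))} [IsFiniteMeasure μ] [IsFiniteMeasure ν]

theorem abs_inner_mul_inner_le (w u v : EuclideanSpace ℝ (Fin d)) :
    |⟪w, u⟫_ℝ * ⟪w, v⟫_ℝ| ≤ ‖u‖ * ‖v‖ * ‖w‖ ^ 2 := by
  rw [abs_mul]
  calc _ ≤ (‖w‖ * ‖u‖) * (‖w‖ * ‖v‖) :=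
        mul_le_mul (abs_real_inner_le_norm _ _) (abs_real_inner_le_norm _ _) (abs_nonneg _)
          (by positivity)
    _ = _ := by ring

theorem integrable_inner_mul_inner (hμ : MemLp id (2 : ℕ) μ) (u v : EuclideanSpace ℝ (Fin d)) :
    Integrable (fun w => ⟪w, u⟫_ℝ * ⟪w, v⟫_ℝ) μ :=
  integrable_of_le_norm_pow hμ le_rfl (by fun_prop) fun w => abs_inner_mul_inner_le w u v

theorem hasDerivAt_cosInt_line_one (hμ : MemLp id (2 : ℕ) μ)
    (z v : EuclideanSpace ℝ (Fin d)) (t : ℝ) :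
    HasDerivAt (fun s : ℝ => cosInt μ (fun _ => 1) 0 (z + s • v))
      (cosInt μ (fun w => ⟪w, v⟫_ℝ) (Real.pi / 2) (z + t • v)) t := by
  have := hasDerivAt_cosInt_line (μ := μ) (a := fun _ => 1) (integrable_const _)
    (integrable_of_le_norm_pow hμ (n := 1) (by norm_num) (by fun_prop) (C := 1) fun w => by simp)
    0 z v t
  simpa only [one_mul, zero_add] using this

theorem hasDerivAt_cosInt_line_inner (hμ : MemLp id (2 : ℕ) μ)
    (z v u : EuclideanSpace ℝ (Fin d)) (t : ℝ) :
    HasDerivAt (fun s : ℝ => cosInt μ (fun w => ⟪w, v⟫_ℝ) (Real.pi / 2) (z + s • u))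
      (cosInt μ (fun w => ⟪w, v⟫_ℝ * ⟪w, u⟫_ℝ) Real.pi (z + t • u)) t := by
  have := hasDerivAt_cosInt_line (μ := μ) (a := fun w => ⟪w, v⟫_ℝ)
    (integrable_of_le_norm_pow hμ (n := 1) (by norm_num) (by fun_prop) (C := ‖v‖) fun w => by
      rw [pow_one, mul_comm]; exact abs_real_inner_le_norm _ _)
    (integrable_of_le_norm_pow hμ (n := 2) (by norm_num) (by fun_prop) (C := ‖v‖) fun w => by
      rw [abs_mul, abs_abs, abs_norm, pow_two, ← mul_assoc, mul_comm ‖v‖]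
      gcongr
      exact abs_real_inner_le_norm _ _)
    (Real.pi / 2) z u t
  simpa only [add_halves] using this

/-- The cosine in the second derivative is bounded by 1. The integral that remains is then estimated
by `L²` for `Λ` and by the mean of `‖w‖²` for the empirical measure. -/
theorem abs_crossDiff_cosInt_le (hμ : MemLp id (2 : ℕ) μ) (hX : Convex ℝ X) (x y : PSeq X)
    (i : Fin x.len) (j : Fin y.len) :
    |crossDiff (fun x y => cosInt μ (fun _ => 1) 0 (x - y)) x y i j| ≤
      ∫ w, |⟪w, x.pt i.succ - x.pt i.castSucc⟫_ℝ * ⟪w, y.pt j.succ - y.pt j.castSucc⟫_ℝ| ∂μ := by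
  obtain ⟨z, -, hz⟩ := exists_crossDiff_eq hX (hasDerivAt_cosInt_line_one hμ)
    (hasDerivAt_cosInt_line_inner hμ) x y i j
  rw [hz]
  refine (abs_cosInt_le _ (integrable_inner_mul_inner hμ _ _) _ _).trans (le_of_eq ?_)
  simp only [inner_neg_right, mul_neg, abs_neg]

theorem sum_abs_le (v : EuclideanSpace ℝ (Fin d)) : ∑ i, |v i| ≤ √d * ‖v‖ := by
  have h := sq_sum_le_card_mul_sum_sq (s := Finset.univ) (f := fun i : Fin d => |v i|)
  simp only [sq_abs, Finset.card_univ, Fintype.card_fin] at h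
  rw [← EuclideanSpace.real_norm_sq_eq] at h
  refine le_of_sq_le_sq ?_ (by positivity)
  rw [mul_pow, Real.sq_sqrt (Nat.cast_nonneg d)]
  exact h

theorem cosInt_inner_mul_inner (hμ : MemLp id (2 : ℕ) μ) (u v z : EuclideanSpace ℝ (Fin d))
    (c : ℝ) :
    cosInt μ (fun w => ⟪w, u⟫_ℝ * ⟪w, v⟫_ℝ) c z
      = ∑ i, ∑ j, u i * v j * cosInt μ (fun w => w i * w j) c z := by
  simp only [cosInt, ← integral_const_mul]
  have hi : ∀ i j : Fin d, Integrable (fun w : EuclideanSpace ℝ (Fin d) =>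
      u i * v j * (w i * w j * Real.cos (⟪w, z⟫_ℝ + c))) μ := fun i j => by
    refine (integrable_mul_cos (a := fun w => w i * w j) ?_ c z).const_mul _
    refine integrable_of_le_norm_pow hμ (n := 2) le_rfl (by fun_prop) (C := 1) fun w => ?_
    rw [abs_mul, one_mul, pow_two]
    gcongr <;> exact abs_coord_le w _
  have : ∀ i, ∑ j, ∫ w, u i * v j * (w i * w j * Real.cos (⟪w, z⟫_ℝ + c)) ∂μ
      = ∫ w, ∑ j, u i * v j * (w i * w j * Real.cos (⟪w, z⟫_ℝ + c)) ∂μ := fun i =>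
    (integral_finsetSum _ fun j _ => hi i j).symm
  simp only [this]
  rw [← integral_finsetSum _ fun i _ => integrable_finsetSum _ fun j _ => hi i j]
  congr 1; ext w
  simp only [PiLp.inner_apply, RCLike.inner_apply, conj_trivial, Finset.sum_mul]
  refine Finset.sum_congr rfl fun i _ => ?_
  rw [Finset.mul_sum, Finset.sum_mul]
  exact Finset.sum_congr rfl fun j _ => by ring

/-- Entrywise control of the Hessian of the difference of two kernels controls the difference of
their cross-differences. -/
theorem abs_crossDiff_sub_le (hμ : MemLp id (2 : ℕ) μ) (hν : MemLp id (2 : ℕ) ν)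
    (hX : Convex ℝ X) {t : ℝ}
    (ht : ∀ z ∈ diffSet X, ∀ i j : Fin d,
      |cosInt μ (fun w => w i * w j) Real.pi z - cosInt ν (fun w => w i * w j) Real.pi z| ≤ t)
    (x y : PSeq X) (i : Fin x.len) (j : Fin y.len) :
    |crossDiff (fun x y => cosInt μ (fun _ => 1) 0 (x - y)) x y i j
      - crossDiff (fun x y => cosInt ν (fun _ => 1) 0 (x - y)) x y i j| ≤
      d * t * (‖x.pt i.succ - x.pt i.castSucc‖ * ‖y.pt j.succ - y.pt j.castSucc‖) := by
  obtain ⟨z, hzX, hz⟩ := exists_crossDiff_eq hX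
    (h := fun z => cosInt μ (fun _ => 1) 0 z - cosInt ν (fun _ => 1) 0 z)
    (h' := fun v z => cosInt μ (fun w => ⟪w, v⟫_ℝ) (Real.pi / 2) z
      - cosInt ν (fun w => ⟪w, v⟫_ℝ) (Real.pi / 2) z)
    (h'' := fun v u z => cosInt μ (fun w => ⟪w, v⟫_ℝ * ⟪w, u⟫_ℝ) Real.pi z
      - cosInt ν (fun w => ⟪w, v⟫_ℝ * ⟪w, u⟫_ℝ) Real.pi z)
    (fun z v t => (hasDerivAt_cosInt_line_one hμ z v t).sub
      (hasDerivAt_cosInt_line_one hν z v t))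
    (fun z v u t => (hasDerivAt_cosInt_line_inner hμ z v u t).sub
      (hasDerivAt_cosInt_line_inner hν z v u t)) x y i j
  set v := x.pt i.succ - x.pt i.castSucc
  set u := y.pt j.succ - y.pt j.castSucc
  have h1 : crossDiff (fun x y => cosInt μ (fun _ => 1) 0 (x - y)) x y i j
      - crossDiff (fun x y => cosInt ν (fun _ => 1) 0 (x - y)) x y i j
      = ∑ i, ∑ j, v i * (-u) j * (cosInt μ (fun w => w i * w j) Real.pi z
        - cosInt ν (fun w => w i * w j) Real.pi z) := by
    calc _ = _ := by simp only [crossDiff]; ring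
      _ = _ := hz
      _ = _ := by
        rw [cosInt_inner_mul_inner hμ, cosInt_inner_mul_inner hν]
        simp only [← Finset.sum_sub_distrib, mul_sub]
  have ht0 : 0 ≤ t ∨ d = 0 := by
    rcases Nat.eq_zero_or_pos d with h | h
    · exact Or.inr h
    · exact Or.inl ((abs_nonneg _).trans (ht z hzX ⟨0, h⟩ ⟨0, h⟩))
  rcases ht0 with ht0 | rfl
  · rw [h1]
    calc _ ≤ ∑ i, ∑ j, |v i| * |u j| * t := by
          refine (Finset.abs_sum_le_sum_abs _ _).trans (Finset.sum_le_sum fun i _ => ?_)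
          refine (Finset.abs_sum_le_sum_abs _ _).trans (Finset.sum_le_sum fun j _ => ?_)
          rw [abs_mul, abs_mul, PiLp.neg_apply, abs_neg]
          gcongr
          exact ht z hzX i j
      _ = (∑ i, |v i|) * (∑ j, |u j|) * t := by
          rw [Finset.sum_mul_sum]
          simp only [Finset.sum_mul]
      -- Passing from `ℓ¹` to `ℓ²` costs `√d` for each increment, whence the factor `d`.
      _ ≤ (√d * ‖v‖) * (√d * ‖u‖) * t := by
          exact mul_le_mul_of_nonneg_right (mul_le_mul (sum_abs_le v) (sum_abs_le u)
            (Finset.sum_nonneg fun _ _ => abs_nonneg _) (by positivity)) ht0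
      _ = (√d * √d) * t * (‖v‖ * ‖u‖) := by ring
      _ = _ := by rw [Real.mul_self_sqrt (Nat.cast_nonneg d)]
  · rw [h1]; simp

end CrossDiff

/-! ### Combinatorics of the signature sums -/

section Deterministic

/-- The sum over strictly increasing tuples is at most `1 / m!` times the sum over all tuples. -/
theorem factorial_mul_sum_orderEmbedding_le (m : ℕ) {l : ℕ} (a : Fin l → ℝ) (ha : ∀ i, 0 ≤ a i) :
    (m.factorial : ℝ) * ∑ i : Fin m ↪o Fin l, ∏ p, a (i p) ≤ (∑ i, a i) ^ m := by
  classical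
  have h1 : (m.factorial : ℝ) * ∑ i : Fin m ↪o Fin l, ∏ p, a (i p)
      = ∑ q : Equiv.Perm (Fin m) × (Fin m ↪o Fin l), ∏ p, a (q.2 (q.1 p)) := by
    rw [Fintype.sum_prod_type]
    have : ∀ s : Equiv.Perm (Fin m), ∑ i : Fin m ↪o Fin l, ∏ p, a (i (s p))
        = ∑ i : Fin m ↪o Fin l, ∏ p, a (i p) := fun s =>
      Finset.sum_congr rfl fun i _ => Equiv.prod_comp s fun p => a (i p)
    simp only [this, Finset.sum_const, Finset.card_univ, Fintype.card_perm, Fintype.card_fin,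
      nsmul_eq_mul]
  -- The range of a rearranged tuple determines the increasing tuple, and then the permutation. The
  -- `m!` rearrangements are thus distinct terms of the expanded power.
  have hinj : Function.Injective
      (fun (q : Equiv.Perm (Fin m) × (Fin m ↪o Fin l)) (p : Fin m) => q.2 (q.1 p)) := by
    rintro ⟨s, i⟩ ⟨s', i'⟩ h
    have hr : Set.range i = Set.range i' := by
      have e1 : Set.range (i ∘ s) = Set.range i := s.surjective.range_comp i
      have e2 : Set.range (i' ∘ s') = Set.range i' := s'.surjective.range_comp i'
      rw [← e1, ← e2]
      exact congrArg Set.range h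
    have hi : i = i' := DFunLike.coe_injective
      ((StrictMono.range_inj i.strictMono i'.strictMono).1 hr)
    subst hi
    refine Prod.ext (Equiv.ext fun p => i.injective (congrFun h p)) rfl
  rw [h1, Fintype.sum_pow]
  rw [← Finset.sum_image (f := fun g : Fin m → Fin l => ∏ p, a (g p))
    (g := fun (q : Equiv.Perm (Fin m) × (Fin m ↪o Fin l)) (p : Fin m) => q.2 (q.1 p))
    hinj.injOn]
  exact Finset.sum_le_sum_of_subset_of_nonneg (Finset.subset_univ _)
    fun g _ _ => Finset.prod_nonneg fun p _ => ha _

/-- Telescoping, one factor at a time. The extra factor `K` on the left avoids the exponent `card -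
1` in the induction. -/
theorem abs_prod_sub_prod_le {ι : Type*} (s : Finset ι) (a b u : ι → ℝ) {t K : ℝ} (ht : 0 ≤ t)
    (hK : 0 ≤ K) (hu : ∀ p, 0 ≤ u p) (ha : ∀ p, |a p| ≤ K * u p) (hb : ∀ p, |b p| ≤ K * u p)
    (hab : ∀ p, |a p - b p| ≤ t * u p) :
    K * |∏ p ∈ s, a p - ∏ p ∈ s, b p| ≤ s.card * t * K ^ s.card * ∏ p ∈ s, u p := by
  classical
  induction s using Finset.induction_on with
  | empty => simp
  | insert i s hi ih =>
    rw [Finset.prod_insert hi, Finset.prod_insert hi, Finset.prod_insert hi,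
      Finset.card_insert_of_notMem hi]
    have hbs : |∏ p ∈ s, b p| ≤ K ^ s.card * ∏ p ∈ s, u p := by
      rw [Finset.abs_prod, ← Finset.prod_const, ← Finset.prod_mul_distrib]
      exact Finset.prod_le_prod (fun _ _ => abs_nonneg _) fun p _ => hb p
    have hU : 0 ≤ ∏ p ∈ s, u p := Finset.prod_nonneg fun p _ => hu p
    calc K * |a i * ∏ p ∈ s, a p - b i * ∏ p ∈ s, b p|
        = K * |a i * (∏ p ∈ s, a p - ∏ p ∈ s, b p) + (a i - b i) * ∏ p ∈ s, b p| := by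
          congr 2; ring
      _ ≤ K * (|a i| * |∏ p ∈ s, a p - ∏ p ∈ s, b p| + |a i - b i| * |∏ p ∈ s, b p|) := by
          gcongr
          refine (abs_add_le _ _).trans (le_of_eq ?_)
          rw [abs_mul, abs_mul]
      _ = |a i| * (K * |∏ p ∈ s, a p - ∏ p ∈ s, b p|) + K * (|a i - b i| * |∏ p ∈ s, b p|) := by
          ring
      _ ≤ (K * u i) * (s.card * t * K ^ s.card * ∏ p ∈ s, u p)
          + K * ((t * u i) * (K ^ s.card * ∏ p ∈ s, u p)) := by
          have := hu i
          refine add_le_add (mul_le_mul (ha i) ih (by positivity) (by positivity)) ?_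
          exact mul_le_mul_of_nonneg_left
            (mul_le_mul (hab i) hbs (abs_nonneg _) (by positivity)) hK
      _ = _ := by push_cast; ring

variable {d : ℕ} {X : Set (EuclideanSpace ℝ (Fin d))}

theorem PSeq.oneVar_nonneg (x : PSeq X) : 0 ≤ x.oneVar :=
  Finset.sum_nonneg fun _ _ => norm_nonneg _

/-- Comparison of the signature kernels of two families of static kernels. -/
theorem abs_sigKernel_sub_le {m : ℕ} (hm : 1 ≤ m)
    {k : EuclideanSpace ℝ (Fin d) → EuclideanSpace ℝ (Fin d) → ℝ}
    {k' : Fin m → EuclideanSpace ℝ (Fin d) → EuclideanSpace ℝ (Fin d) → ℝ} {t K V : ℝ}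
    (ht : 0 ≤ t) (hK : 0 < K) (x y : PSeq X) (hx : x.oneVar ≤ V) (hy : y.oneVar ≤ V)
    (h1 : ∀ i j, |crossDiff k x y i j| ≤
      K * (‖x.pt i.succ - x.pt i.castSucc‖ * ‖y.pt j.succ - y.pt j.castSucc‖))
    (h2 : 2 ≤ m → ∀ p i j, |crossDiff (k' p) x y i j| ≤
      K * (‖x.pt i.succ - x.pt i.castSucc‖ * ‖y.pt j.succ - y.pt j.castSucc‖))
    (h3 : ∀ p i j, |crossDiff k x y i j - crossDiff (k' p) x y i j| ≤
      t * (‖x.pt i.succ - x.pt i.castSucc‖ * ‖y.pt j.succ - y.pt j.castSucc‖)) :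
    |sigKernel k m x y - ∑ i : Fin m ↪o Fin x.len, ∑ j : Fin m ↪o Fin y.len,
      ∏ p, crossDiff (k' p) x y (i p) (j p)| ≤
      m * t * K ^ (m - 1) * (V ^ m / m.factorial) ^ 2 := by
  set u : Fin x.len → ℝ := fun i => ‖x.pt i.succ - x.pt i.castSucc‖ with hu
  set v : Fin y.len → ℝ := fun j => ‖y.pt j.succ - y.pt j.castSucc‖ with hv
  have hterm : ∀ (i : Fin m ↪o Fin x.len) (j : Fin m ↪o Fin y.len),
      |∏ p, crossDiff k x y (i p) (j p) - ∏ p, crossDiff (k' p) x y (i p) (j p)| ≤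
        m * t * K ^ (m - 1) * ((∏ p, u (i p)) * ∏ p, v (j p)) := by
    intro i j
    rw [← Finset.prod_mul_distrib]
    -- At level 1 there is a single factor, so no a priori bound on the random cross-differences is
    -- needed; this keeps the second-moment event out of the case `m = 1`.
    rcases Nat.lt_or_ge m 2 with h | h
    · obtain rfl : m = 1 := by omega
      simpa using h3 0 (i 0) (j 0)
    · have := abs_prod_sub_prod_le (Finset.univ : Finset (Fin m))
        (fun p => crossDiff k x y (i p) (j p)) (fun p => crossDiff (k' p) x y (i p) (j p))
        (fun p => u (i p) * v (j p)) ht hK.le (fun p => by positivity) (fun p => h1 _ _)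
        (fun p => h2 h p _ _) (fun p => h3 p _ _)
      rw [Finset.card_univ, Fintype.card_fin] at this
      refine le_of_mul_le_mul_left (this.trans (le_of_eq ?_)) hK
      obtain ⟨n, rfl⟩ : ∃ n, m = n + 1 := ⟨m - 1, by omega⟩
      rw [Nat.add_sub_cancel]
      ring
  have hsum : ∀ (z : PSeq X), z.oneVar ≤ V →
      ∑ i : Fin m ↪o Fin z.len, ∏ p, ‖z.pt (i p).succ - z.pt (i p).castSucc‖
        ≤ V ^ m / m.factorial := by
    intro z hz
    rw [le_div_iff₀' (by positivity)]
    refine (factorial_mul_sum_orderEmbedding_le m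
      (fun i => ‖z.pt i.succ - z.pt i.castSucc‖) fun i => norm_nonneg _).trans ?_
    exact pow_le_pow_left₀ z.oneVar_nonneg hz m
  calc _ = |∑ i : Fin m ↪o Fin x.len, ∑ j : Fin m ↪o Fin y.len,
        (∏ p, crossDiff k x y (i p) (j p) - ∏ p, crossDiff (k' p) x y (i p) (j p))| := by
        simp only [sigKernel, Finset.sum_sub_distrib]
    _ ≤ ∑ i : Fin m ↪o Fin x.len, ∑ j : Fin m ↪o Fin y.len,
        m * t * K ^ (m - 1) * ((∏ p, u (i p)) * ∏ p, v (j p)) := by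
        refine (Finset.abs_sum_le_sum_abs _ _).trans (Finset.sum_le_sum fun i _ => ?_)
        exact (Finset.abs_sum_le_sum_abs _ _).trans (Finset.sum_le_sum fun j _ => hterm i j)
    _ = m * t * K ^ (m - 1) * ((∑ i : Fin m ↪o Fin x.len, ∏ p, u (i p)) *
          ∑ j : Fin m ↪o Fin y.len, ∏ p, v (j p)) := by
        rw [Finset.sum_mul_sum]
        simp only [Finset.mul_sum]
    _ ≤ m * t * K ^ (m - 1) * ((V ^ m / m.factorial) * (V ^ m / m.factorial)) := by
        refine mul_le_mul_of_nonneg_left ?_ (by positivity)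
        exact mul_le_mul (hsum x hx) (hsum y hy)
          (Finset.sum_nonneg fun j _ => Finset.prod_nonneg fun p _ => norm_nonneg _)
          ((Finset.sum_nonneg fun j _ => Finset.prod_nonneg fun p _ => norm_nonneg _).trans
            (hsum x hx))
    _ = _ := by ring

end Deterministic

/-! ### Finite nets from volume comparison -/

section Covering

variable {E : Type*} [NormedAddCommGroup E] [NormedSpace ℝ E] [FiniteDimensional ℝ E]

/-- The volume bound for the cardinality of a separated subset of a ball. -/
theorem card_le_of_separated {ρ r : ℝ} (hρ : 0 ≤ ρ) (hr : 0 < r) (s : Finset E)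
    (hs : ∀ c ∈ s, ‖c‖ ≤ ρ) (h : ∀ c ∈ s, ∀ e ∈ s, c ≠ e → r ≤ ‖c - e‖) :
    (s.card : ℝ) ≤ ((2 * ρ + r) / r) ^ Module.finrank ℝ E := by
  borelize E
  let μ : Measure E := Measure.addHaar
  have hrho : 0 < ρ + r / 2 := by positivity
  have hr2 : 0 < r / 2 := by positivity
  have hdisj : Set.Pairwise (s : Set E) (Function.onFun Disjoint fun c => Metric.ball c (r / 2)) := by
    rintro c hc e he hce
    apply Metric.ball_disjoint_ball
    rw [dist_eq_norm, add_halves]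
    exact h c hc e he hce
  have hsub : (⋃ c ∈ s, Metric.ball c (r / 2)) ⊆ Metric.ball (0 : E) (ρ + r / 2) := by
    refine Set.iUnion₂_subset fun x hx => Metric.ball_subset_ball' ?_
    rw [dist_zero_right, add_comm]
    exact add_le_add (hs x hx) le_rfl
  have hI : (s.card : ℝ≥0∞) * ENNReal.ofReal ((r / 2) ^ Module.finrank ℝ E) * μ (Metric.ball 0 1) ≤
      ENNReal.ofReal ((ρ + r / 2) ^ Module.finrank ℝ E) * μ (Metric.ball 0 1) :=
    calc _ = μ (⋃ c ∈ s, Metric.ball c (r / 2)) := by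
          rw [measure_biUnion_finset hdisj fun c _ => measurableSet_ball]
          simp only [μ.addHaar_ball_of_pos _ hr2, Finset.sum_const, nsmul_eq_mul, mul_assoc]
      _ ≤ μ (Metric.ball (0 : E) (ρ + r / 2)) := measure_mono hsub
      _ = _ := by rw [μ.addHaar_ball_of_pos _ hrho]
  have hJ := (ENNReal.mul_le_mul_iff_left (Metric.measure_ball_pos _ _ zero_lt_one).ne'
    measure_ball_lt_top.ne).1 hI
  have hK := ENNReal.toReal_le_of_le_ofReal (by positivity) hJ
  rw [ENNReal.toReal_mul, ENNReal.toReal_natCast, ENNReal.toReal_ofReal (by positivity),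
    ← le_div_iff₀ (by positivity), ← div_pow] at hK
  convert! hK using 2
  field_simp

/-- A subset of a ball has a finite net whose cardinality obeys the volume bound. -/
theorem exists_finset_net {ρ r : ℝ} (hρ : 0 ≤ ρ) (hr : 0 < r) (A : Set E)
    (hA : ∀ c ∈ A, ‖c‖ ≤ ρ) :
    ∃ s : Finset E, (↑s ⊆ A) ∧ (∀ z ∈ A, ∃ c ∈ s, ‖z - c‖ ≤ r) ∧
      (s.card : ℝ) ≤ ((2 * ρ + r) / r) ^ Module.finrank ℝ E := by
  classical
  -- A separated subset of largest cardinality is a net, since a point farther than `r` from it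
  -- could be added. The volume bound guarantees that the maximum exists.
  let Q : ℕ → Prop := fun n => ∃ s : Finset E, (↑s ⊆ A) ∧
    (∀ c ∈ s, ∀ e ∈ s, c ≠ e → r ≤ ‖c - e‖) ∧ s.card = n
  have hbound : ∀ n, Q n → n ≤ ⌊((2 * ρ + r) / r) ^ Module.finrank ℝ E⌋₊ := by
    rintro n ⟨s, hsA, hsep, rfl⟩
    exact Nat.le_floor (card_le_of_separated hρ hr s (fun c hc => hA c (hsA hc)) hsep)
  have h0 : Q 0 := ⟨∅, by simp, by simp, rfl⟩
  obtain ⟨s, hsA, hsep, hcard⟩ := Nat.findGreatest_spec (P := Q) (Nat.zero_le _) h0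
  refine ⟨s, hsA, fun z hz => ?_, card_le_of_separated hρ hr s (fun c hc => hA c (hsA hc)) hsep⟩
  by_contra! hfar
  have hzs : z ∉ s := fun hzs => by
    have := hfar z hzs
    rw [sub_self, norm_zero] at this
    linarith
  have hQ : Q (s.card + 1) := by
    refine ⟨insert z s, ?_, ?_, Finset.card_insert_of_notMem hzs⟩
    · rw [Finset.coe_insert]
      exact Set.insert_subset hz hsA
    · intro c hc e he hce
      rw [Finset.mem_insert] at hc he
      rcases hc with rfl | hc <;> rcases he with rfl | he
      · exact absurd rfl hce
      · exact (hfar e he).le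
      · rw [norm_sub_rev]; exact (hfar c hc).le
      · exact hsep c hc e he hce
  have := Nat.le_findGreatest (P := Q) (hbound _ hQ) hQ
  rw [← hcard] at this
  omega

end Covering

/-! ### Moments and derivatives for the spectral and empirical measures -/

section SpectralMoments

variable {d : ℕ}

section Empirical

/-- The empirical measure of the weights `W`. -/
noncomputable def empirical {D : ℕ} (W : Fin D → EuclideanSpace ℝ (Fin d)) :
    Measure (EuclideanSpace ℝ (Fin d)) :=
  ((D : NNReal)⁻¹ • (Measure.count : Measure (Fin D))).map W

variable {D : ℕ} (W : Fin D → EuclideanSpace ℝ (Fin d))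

instance : IsFiniteMeasure (empirical W) := by unfold empirical; infer_instance

theorem integral_empirical {f : EuclideanSpace ℝ (Fin d) → ℝ} (hf : Measurable f) :
    ∫ w, f w ∂(empirical W) = (1 / (D : ℝ)) * ∑ j, f (W j) := by
  rw [empirical, integral_map (measurable_of_finite W).aemeasurable hf.aestronglyMeasurable,
    integral_smul_nnreal_measure, integral_count, NNReal.smul_def]
  simp

theorem memLp_empirical (p : ℝ≥0∞) : MemLp id p (empirical W) := by
  refine MemLp.of_bound (by fun_prop) (∑ j, ‖W j‖) ?_
  rw [empirical, ae_map_iff (measurable_of_finite W).aemeasurable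
    (measurableSet_le (by fun_prop) (by fun_prop))]
  exact Filter.Eventually.of_forall fun j =>
    Finset.single_le_sum (f := fun j => ‖W j‖) (fun _ _ => norm_nonneg _) (Finset.mem_univ j)

/-- This puts the random kernel in the same form as `k`, so the calculus of `cosInt` serves both. -/
theorem rffKernel_eq_cosInt (x y : EuclideanSpace ℝ (Fin d)) :
    rffKernel W x y = cosInt (empirical W) (fun _ => 1) 0 (x - y) := by
  rw [cosInt, integral_empirical W (by fun_prop)]
  simp [rffKernel]

/-- The empirical second moment bounds the cross-differences of the random Fourier feature
kernel. -/
theorem abs_crossDiff_rffKernel_le {X : Set (EuclideanSpace ℝ (Fin d))} (hX : Convex ℝ X)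
    (x y : PSeq X) (i : Fin x.len) (j : Fin y.len) :
    |crossDiff (rffKernel W) x y i j| ≤ ((1 / (D : ℝ)) * ∑ l, ‖W l‖ ^ 2) *
      (‖x.pt i.succ - x.pt i.castSucc‖ * ‖y.pt j.succ - y.pt j.castSucc‖) := by
  have h := abs_crossDiff_cosInt_le (memLp_empirical W 2) hX x y i j
  have h1 : rffKernel W = fun x y => cosInt (empirical W) (fun _ => 1) 0 (x - y) := by
    ext x y; exact rffKernel_eq_cosInt W x y
  rw [← h1, integral_empirical W (by fun_prop)] at h
  refine h.trans ?_
  rw [mul_assoc, Finset.sum_mul]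
  gcongr with l
  exact (abs_inner_mul_inner_le _ _ _).trans (le_of_eq (mul_comm _ _))

end Empirical

section Spectral

variable {k : EuclideanSpace ℝ (Fin d) → EuclideanSpace ℝ (Fin d) → ℝ}
  {Λ : Measure (EuclideanSpace ℝ (Fin d))} [IsProbabilityMeasure Λ]

theorem cosInt_one_eq_re_charFun (z : EuclideanSpace ℝ (Fin d)) :
    cosInt Λ (fun _ => 1) 0 z = (charFun Λ z).re := by
  have hint : Integrable (fun w : EuclideanSpace ℝ (Fin d) =>
      Complex.exp ((⟪w, z⟫_ℝ : ℂ) * Complex.I)) Λ := by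
    refine (integrable_const (1 : ℝ)).mono' (by fun_prop) (Filter.Eventually.of_forall fun w => ?_)
    rw [Complex.norm_exp_ofReal_mul_I]
  rw [charFun_apply, ← RCLike.re_eq_complex_re, ← integral_re hint, cosInt]
  congr 1; ext w
  rw [RCLike.re_eq_complex_re, Complex.exp_ofReal_mul_I_re, add_zero, one_mul]

theorem IsSpectralMeasure.eq_cosInt (hΛ : IsSpectralMeasure Λ k)
    (x y : EuclideanSpace ℝ (Fin d)) : k x y = cosInt Λ (fun _ => 1) 0 (x - y) := by
  rw [cosInt_one_eq_re_charFun, charFun_apply]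
  have := hΛ x y
  simp only [mul_comm Complex.I] at this
  rw [← this, Complex.ofReal_re]

theorem IsSpectralMeasure.profile_eq (hΛ : IsSpectralMeasure Λ k) :
    profile k = cosInt Λ (fun _ => 1) 0 := by
  ext z
  rw [profile, hΛ.eq_cosInt, sub_zero]

theorem IsSpectralMeasure.contDiff_profile (hΛ : IsSpectralMeasure Λ k)
    (h3 : MemLp id (3 : ℕ) Λ) : ContDiff ℝ 3 (profile k) := by
  rw [hΛ.profile_eq, funext cosInt_one_eq_re_charFun]
  exact Complex.reCLM.contDiff.comp (contDiff_charFun (n := 3) h3)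

/-- The case `n = 2` bounds the fourth moments of the coordinates, and `‖w‖⁴ ≤ d ∑ |w_i|⁴` by
Cauchy–Schwarz. Third moments are what `E_{i,j}` and three derivatives of `k` require. -/
theorem memLp_of_bernstein {S R : ℝ} (hmom : BernsteinCondition Λ S R) :
    MemLp id (3 : ℕ) Λ := by
  have h4 : MemLp id (4 : ℕ) Λ := by
    rw [← integrable_norm_rpow_iff (by fun_prop) (by simp) (by simp)]
    simp only [ENNReal.toReal_natCast, Real.rpow_natCast, id]
    have hi : Integrable (fun w : EuclideanSpace ℝ (Fin d) => d * ∑ i, |w i| ^ (2 * 2)) Λ :=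
      (integrable_finsetSum _ fun i _ => (hmom i 2 le_rfl).1).const_mul _
    refine hi.mono' (by fun_prop) (Filter.Eventually.of_forall fun w => ?_)
    rw [norm_pow, norm_norm]
    have := sq_sum_le_card_mul_sum_sq (s := Finset.univ) (f := fun i : Fin d => |w i| ^ 2)
    simp only [sq_abs] at this
    rw [← EuclideanSpace.real_norm_sq_eq, Finset.card_univ, Fintype.card_fin] at this
    calc ‖w‖ ^ 4 = (‖w‖ ^ 2) ^ 2 := by ring
      _ ≤ _ := this
      _ = _ := by simp only [pow_mul, sq_abs]
  exact h4.mono_exponent (by exact_mod_cast (by norm_num : 3 ≤ 4))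

/-- The quadratic form of `𝔼 [w wᵀ]` gives `𝔼 ⟪w, u⟫² ≤ L² ‖u‖²`. Cauchy–Schwarz in `L²(Λ)` is
carried out as AM–GM with the balancing weights `‖v‖ / ‖u‖` and `‖u‖ / ‖v‖`. -/
theorem integral_abs_inner_mul_inner_le (h2 : MemLp id (2 : ℕ) Λ)
    (u v : EuclideanSpace ℝ (Fin d)) :
    ∫ w, |⟪w, u⟫_ℝ * ⟪w, v⟫_ℝ| ∂Λ ≤ lipConst Λ ^ 2 * (‖u‖ * ‖v‖) := by
  rw [lipConst, Real.sq_sqrt (norm_nonneg _)]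
  set N := ‖Matrix.toEuclideanCLM (n := Fin d) (𝕜 := ℝ) (secondMoment Λ)‖ with hN
  have hsq : ∀ u : EuclideanSpace ℝ (Fin d), ∫ w, ⟪w, u⟫_ℝ * ⟪w, u⟫_ℝ ∂Λ ≤ N * ‖u‖ ^ 2 := by
    intro u
    have hc := cosInt_inner_mul_inner h2 u u 0 0
    simp only [cosInt, inner_zero_right, add_zero, Real.cos_zero, mul_one] at hc
    have e : ∑ i, ∑ j, u i * u j * ∫ w, w i * w j ∂Λ
        = ⟪u, Matrix.toEuclideanCLM (𝕜 := ℝ) (secondMoment Λ) u⟫_ℝ := by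
      rw [Matrix.inner_toEuclideanCLM]
      simp only [dotProduct, Matrix.mulVec, secondMoment, Matrix.of_apply, Finset.mul_sum]
      refine Finset.sum_congr rfl fun i _ => Finset.sum_congr rfl fun j _ => by ring
    rw [hc, e]
    calc _ ≤ ‖u‖ * ‖Matrix.toEuclideanCLM (𝕜 := ℝ) (secondMoment Λ) u‖ :=
          real_inner_le_norm _ _
      _ ≤ ‖u‖ * (N * ‖u‖) := by gcongr; exact ContinuousLinearMap.le_opNorm _ _
      _ = _ := by ring
  rcases eq_or_ne u 0 with rfl | hu
  · simp
  rcases eq_or_ne v 0 with rfl | hv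
  · simp
  have ha : 0 < ‖u‖ := norm_pos_iff.2 hu
  have hb : 0 < ‖v‖ := norm_pos_iff.2 hv
  have hiu := integrable_inner_mul_inner h2 u u
  have hiv := integrable_inner_mul_inner h2 v v
  calc ∫ w, |⟪w, u⟫_ℝ * ⟪w, v⟫_ℝ| ∂Λ
      ≤ ∫ w, (‖v‖ / (2 * ‖u‖) * (⟪w, u⟫_ℝ * ⟪w, u⟫_ℝ)
        + ‖u‖ / (2 * ‖v‖) * (⟪w, v⟫_ℝ * ⟪w, v⟫_ℝ)) ∂Λ := by
        refine integral_mono (integrable_inner_mul_inner h2 u v).abs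
          ((hiu.const_mul _).add (hiv.const_mul _)) fun w => ?_
        simp only [abs_mul]
        have key := sq_nonneg (‖v‖ * |⟪w, u⟫_ℝ| - ‖u‖ * |⟪w, v⟫_ℝ|)
        rw [← abs_mul_abs_self ⟪w, u⟫_ℝ, ← abs_mul_abs_self ⟪w, v⟫_ℝ]
        rw [div_mul_eq_mul_div, div_mul_eq_mul_div, div_add_div _ _ (by positivity) (by positivity),
          le_div_iff₀ (by positivity)]
        nlinarith
    _ = ‖v‖ / (2 * ‖u‖) * ∫ w, ⟪w, u⟫_ℝ * ⟪w, u⟫_ℝ ∂Λ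
        + ‖u‖ / (2 * ‖v‖) * ∫ w, ⟪w, v⟫_ℝ * ⟪w, v⟫_ℝ ∂Λ := by
        rw [integral_add (hiu.const_mul _) (hiv.const_mul _), integral_const_mul,
          integral_const_mul]
    _ ≤ ‖v‖ / (2 * ‖u‖) * (N * ‖u‖ ^ 2) + ‖u‖ / (2 * ‖v‖) * (N * ‖v‖ ^ 2) := by
        gcongr
        · exact hsq u
        · exact hsq v
    _ = _ := by field_simp; ring

theorem sigmaSq_eq (h2 : MemLp id (2 : ℕ) Λ) : sigmaSq Λ = ∑ i, ∫ w, w i * w i ∂Λ := by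
  rw [sigmaSq, ← integral_finsetSum]
  · congr 1; ext w
    rw [EuclideanSpace.real_norm_sq_eq]
    simp only [pow_two]
  · intro i _
    refine integrable_of_le_norm_pow h2 (n := 2) le_rfl (by fun_prop) (C := 1) fun w => ?_
    rw [abs_mul, one_mul, pow_two]
    gcongr <;> exact abs_coord_le w _

end Spectral

section SecondDerivatives

variable {k : EuclideanSpace ℝ (Fin d) → EuclideanSpace ℝ (Fin d) → ℝ}
  {μ : Measure (EuclideanSpace ℝ (Fin d))} [IsFiniteMeasure μ]
  {Λ : Measure (EuclideanSpace ℝ (Fin d))} [IsProbabilityMeasure Λ]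
  {X : Set (EuclideanSpace ℝ (Fin d))}

theorem abs_coord_mul_coord_le (w : EuclideanSpace ℝ (Fin d)) (i j : Fin d) :
    |w i * w j| ≤ ‖w‖ ^ 2 := by
  rw [abs_mul, pow_two]
  gcongr <;> exact abs_coord_le w _

theorem integrable_coord_mul_coord (h3 : MemLp id (3 : ℕ) μ) (i j : Fin d) :
    Integrable (fun w : EuclideanSpace ℝ (Fin d) => w i * w j) μ :=
  integrable_of_le_norm_pow h3 (n := 2) (by norm_num) (by fun_prop) (C := 1) fun w => by
    rw [one_mul]; exact abs_coord_mul_coord_le w i j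

theorem integrable_abs_coord_mul_coord_mul_norm (h3 : MemLp id (3 : ℕ) μ) (i j : Fin d) :
    Integrable (fun w : EuclideanSpace ℝ (Fin d) => |w i * w j| * ‖w‖) μ :=
  integrable_of_le_norm_pow h3 (n := 3) le_rfl (by fun_prop) (C := 1) fun w => by
    rw [one_mul, abs_mul, abs_abs, abs_norm, pow_succ]
    gcongr
    exact abs_coord_mul_coord_le w i j

theorem IsSpectralMeasure.partialDeriv_partialDeriv_profile (hΛ : IsSpectralMeasure Λ k)
    (h3 : MemLp id (3 : ℕ) Λ) (i j : Fin d) :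
    partialDeriv i (partialDeriv j (profile k)) = cosInt Λ (fun w => w i * w j) Real.pi := by
  rw [hΛ.profile_eq, partialDeriv_cosInt (integrable_const _)
    (integrable_of_le_norm_pow h3 (n := 1) (by norm_num) (by fun_prop) (C := 1) fun w => by simp),
    partialDeriv_cosInt]
  · simp only [one_mul, zero_add, add_halves, mul_comm]
  · exact integrable_of_le_norm_pow h3 (n := 1) (by norm_num) (by fun_prop) (C := 1) fun w => by
      simpa using abs_coord_le w j
  · refine integrable_of_le_norm_pow h3 (n := 2) (by norm_num) (by fun_prop) (C := 1) fun w => ?_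
    rw [one_mul, one_mul, abs_mul, abs_abs, abs_norm, pow_two]
    gcongr
    exact abs_coord_le w j

theorem norm_gradient (f : EuclideanSpace ℝ (Fin d) → ℝ) (z : EuclideanSpace ℝ (Fin d)) :
    ‖gradient f z‖ = ‖fderiv ℝ f z‖ := by
  rw [gradient, LinearIsometryEquiv.norm_map]

theorem IsSpectralMeasure.bddAbove_gradNorms (hΛ : IsSpectralMeasure Λ k)
    (h3 : MemLp id (3 : ℕ) Λ) (X : Set (EuclideanSpace ℝ (Fin d))) (i j : Fin d) :
    BddAbove (gradNorms k X i j) := by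
  refine ⟨∫ w, |w i * w j| * ‖w‖ ∂Λ, ?_⟩
  rintro _ ⟨z, -, rfl⟩
  simp only [norm_gradient, hΛ.partialDeriv_partialDeriv_profile h3]
  exact norm_fderiv_cosInt_le (integrable_coord_mul_coord h3 i j)
    (integrable_abs_coord_mul_coord_mul_norm h3 i j) _ _

theorem convex_diffSet (hX : Convex ℝ X) : Convex ℝ (diffSet X) := by
  rintro _ ⟨x, hx, y, hy, rfl⟩ _ ⟨x', hx', y', hy', rfl⟩ a b ha hb hab
  refine ⟨a • x + b • x', hX hx hx' ha hb hab, a • y + b • y', hX hy hy' ha hb hab, ?_⟩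
  rw [smul_sub, smul_sub]
  abel

/-- The second derivatives of `k` are Lipschitz on `X_Δ` with constant `D_{i,j}`. -/
theorem IsSpectralMeasure.abs_cosInt_sub_le_Dsup (hΛ : IsSpectralMeasure Λ k)
    (h3 : MemLp id (3 : ℕ) Λ) (hX : Convex ℝ X) (i j : Fin d) {z z' : EuclideanSpace ℝ (Fin d)}
    (hz : z ∈ diffSet X) (hz' : z' ∈ diffSet X) :
    |cosInt Λ (fun w => w i * w j) Real.pi z - cosInt Λ (fun w => w i * w j) Real.pi z'| ≤
      Dsup k X i j * ‖z - z'‖ := by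
  refine abs_cosInt_sub_le (integrable_coord_mul_coord h3 i j)
    (integrable_abs_coord_mul_coord_mul_norm h3 i j) _ (convex_diffSet hX) (fun y hy => ?_) hz hz'
  refine le_csSup (hΛ.bddAbove_gradNorms h3 X i j) ⟨y, hy, ?_⟩
  simp only [norm_gradient, hΛ.partialDeriv_partialDeriv_profile h3]

/-- Meant for the empirical measure: the Lipschitz constant is then random with expectation
`E_{i,j}`, ready for Markov's inequality. -/
theorem abs_cosInt_sub_le_Emom (h3 : MemLp id (3 : ℕ) μ) (i j : Fin d)
    (z z' : EuclideanSpace ℝ (Fin d)) :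
    |cosInt μ (fun w => w i * w j) Real.pi z - cosInt μ (fun w => w i * w j) Real.pi z'| ≤
      (∫ w, |w i * w j| * ‖w‖ ∂μ) * ‖z - z'‖ :=
  abs_cosInt_sub_le (integrable_coord_mul_coord h3 i j)
    (integrable_abs_coord_mul_coord_mul_norm h3 i j) _ convex_univ
    (fun _ _ => norm_fderiv_cosInt_le (integrable_coord_mul_coord h3 i j)
      (integrable_abs_coord_mul_coord_mul_norm h3 i j) _ _) (Set.mem_univ _) (Set.mem_univ _)

theorem Dsup_nonneg (k : EuclideanSpace ℝ (Fin d) → EuclideanSpace ℝ (Fin d) → ℝ)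
    (X : Set (EuclideanSpace ℝ (Fin d))) (i j : Fin d) : 0 ≤ Dsup k X i j := by
  refine Real.sSup_nonneg ?_
  rintro _ ⟨z, -, rfl⟩
  exact norm_nonneg _

theorem Emom_nonneg (Λ : Measure (EuclideanSpace ℝ (Fin d))) (i j : Fin d) : 0 ≤ Emom Λ i j :=
  integral_nonneg fun w => by positivity

end SecondDerivatives

/-- A function dominated by `|w_i w_j|` inherits the Bernstein moment condition. -/
theorem BernsteinCondition.bernsteinMoments
    {Λ : Measure (EuclideanSpace ℝ (Fin d))} {S R : ℝ} (h : BernsteinCondition Λ S R)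
    (i j : Fin d) {f : EuclideanSpace ℝ (Fin d) → ℝ} (hf : Measurable f)
    (hle : ∀ w, |f w| ≤ |w i * w j|) : BernsteinMoments Λ f S R := by
  -- By AM–GM, order-`n` moments of a product reduce to order-`2n` moments of the coordinates, which
  -- is the form of the hypothesis.
  have hb : ∀ (n : ℕ) w, |f w| ^ n ≤ (|w i| ^ (2 * n) + |w j| ^ (2 * n)) / 2 := fun n w => by
    calc |f w| ^ n ≤ |w i * w j| ^ n := pow_le_pow_left₀ (abs_nonneg _) (hle w) n
      _ = |w i| ^ n * |w j| ^ n := by rw [abs_mul, mul_pow]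
      _ ≤ _ := by
        rw [mul_comm 2 n, pow_mul, pow_mul]
        nlinarith [sq_nonneg (|w i| ^ n - |w j| ^ n)]
  have hint : ∀ n, 2 ≤ n → Integrable (fun w : EuclideanSpace ℝ (Fin d) =>
      (|w i| ^ (2 * n) + |w j| ^ (2 * n)) / 2) Λ := fun n hn =>
    ((h i n hn).1.add (h j n hn).1).div_const 2
  have hint' : ∀ n, 2 ≤ n → Integrable (fun w => |f w| ^ n) Λ := fun n hn => by
    refine (hint n hn).mono' (by fun_prop) (Filter.Eventually.of_forall fun w => ?_)
    rw [Real.norm_of_nonneg (by positivity)]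
    exact hb n w
  refine ⟨hf.aemeasurable, hint', fun n hn => ?_⟩
  refine (integral_mono (hint' n hn) (hint n hn) (hb n)).trans ?_
  rw [integral_div, integral_add (h i n hn).1 (h j n hn).1]
  have h1 := (h i n hn).2
  have h2 := (h j n hn).2
  linarith

end SpectralMoments

/-! ### Tail bounds for the Hessian error and the second moments -/

section TailBounds

theorem integrable_comp_of_hasLaw {d D : ℕ}
    {Λ : Measure (EuclideanSpace ℝ (Fin d))} {Ω : Type*} [MeasurableSpace Ω] {P : Measure Ω}
    {W : Fin D → Ω → EuclideanSpace ℝ (Fin d)} (hW : ∀ j, HasLaw (W j) Λ P)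
    {f : EuclideanSpace ℝ (Fin d) → ℝ} (hf : Integrable f Λ) (j : Fin D) :
    Integrable (fun ω => f (W j ω)) P := by
  rw [← (hW j).map_eq] at hf
  exact hf.comp_aemeasurable (hW j).aemeasurable

theorem integral_average_of_hasLaw {d D : ℕ}
    {Λ : Measure (EuclideanSpace ℝ (Fin d))} {Ω : Type*} [MeasurableSpace Ω] {P : Measure Ω}
    {W : Fin D → Ω → EuclideanSpace ℝ (Fin d)} (hW : ∀ j, HasLaw (W j) Λ P) (hD : 1 ≤ D)
    {f : EuclideanSpace ℝ (Fin d) → ℝ} (hf : Integrable f Λ) :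
    ∫ ω, (1 / (D : ℝ)) * ∑ j, f (W j ω) ∂P = ∫ w, f w ∂Λ := by
  have hj : ∀ j, ∫ ω, f (W j ω) ∂P = ∫ w, f w ∂Λ := fun j => by
    have hf' := hf.aestronglyMeasurable
    rw [← (hW j).map_eq] at hf' ⊢
    rw [integral_map (hW j).aemeasurable hf']
  rw [integral_const_mul, integral_finsetSum _ fun j _ => integrable_comp_of_hasLaw hW hf j]
  have : (D : ℝ) ≠ 0 := by positivity
  simp only [hj, Finset.sum_const, Finset.card_univ, Fintype.card_fin, nsmul_eq_mul]
  field_simp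

variable {d D : ℕ} {k : EuclideanSpace ℝ (Fin d) → EuclideanSpace ℝ (Fin d) → ℝ}
  {Λ : Measure (EuclideanSpace ℝ (Fin d))} [IsProbabilityMeasure Λ] {S R : ℝ}
  {X : Set (EuclideanSpace ℝ (Fin d))} {Ω : Type*} [MeasurableSpace Ω] {P : Measure Ω}
  [IsProbabilityMeasure P] {W : Fin D → Ω → EuclideanSpace ℝ (Fin d)}

/-- The error of the random Fourier features in the second derivative `∂²/∂z_i∂z_j`. -/
noncomputable def hessError (Λ : Measure (EuclideanSpace ℝ (Fin d))) (W : Fin D → EuclideanSpace ℝ (Fin d))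
    (i j : Fin d) (z : EuclideanSpace ℝ (Fin d)) : ℝ :=
  cosInt (empirical W) (fun w => w i * w j) Real.pi z - cosInt Λ (fun w => w i * w j) Real.pi z

theorem measureReal_le_abs_hessError_le (hmom : BernsteinCondition Λ S R) (hS : 0 < S)
    (hR : 0 < R) (hW : ∀ j, HasLaw (W j) Λ P) (hind : iIndepFun W P) (hD : 1 ≤ D) {t : ℝ}
    (ht : 0 ≤ t) (i j : Fin d) (z : EuclideanSpace ℝ (Fin d)) :
    P.real {ω | t ≤ |hessError Λ (fun l => W l ω) i j z|} ≤
      2 * Real.exp (-(D * t ^ 2 / (2 * (S ^ 2 + R * t)))) := by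
  set f : EuclideanSpace ℝ (Fin d) → ℝ := fun w => w i * w j * Real.cos (⟪w, z⟫_ℝ + Real.pi)
    with hf
  have hfm : Measurable f := by fun_prop
  have hB : BernsteinMoments Λ f S R := hmom.bernsteinMoments i j hfm fun w => by
    rw [hf, abs_mul (w i * w j)]
    exact mul_le_of_le_one_right (abs_nonneg _) (Real.abs_cos_le_one _)
  have h1 := bernstein hB hfm hS hR hW hind hD ht
  have h2 := bernstein hB.neg hfm.neg hS hR hW hind hD ht
  have hsub : {ω | t ≤ |hessError Λ (fun l => W l ω) i j z|} ⊆
      {ω | (∫ a, f a ∂Λ) + t ≤ (1 / (D : ℝ)) * ∑ j, f (W j ω)} ∪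
      {ω | (∫ a, -f a ∂Λ) + t ≤ (1 / (D : ℝ)) * ∑ j, -f (W j ω)} := by
    intro ω hω
    have e : cosInt (empirical fun l => W l ω) (fun w => w i * w j) Real.pi z
        = (1 / (D : ℝ)) * ∑ j, f (W j ω) := integral_empirical _ hfm
    have hω' : t ≤ |(1 / (D : ℝ)) * ∑ j, f (W j ω) - ∫ a, f a ∂Λ| := by
      rw [← e]; exact hω
    simp only [Set.mem_union, Set.mem_ofPred_eq, integral_neg, Finset.sum_neg_distrib, mul_neg]
    rcases le_abs.1 hω' with h | h
    · left; linarith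
    · right; linarith
  refine (measureReal_mono hsub).trans ((measureReal_union_le _ _).trans ?_)
  linarith

/-- Markov's inequality for the Lipschitz constant of the error in a second derivative. -/
theorem measureReal_le_lipschitz_le (h3 : MemLp id (3 : ℕ) Λ) (hW : ∀ j, HasLaw (W j) Λ P)
    (hD : 1 ≤ D) (i j : Fin d) {r s c : ℝ} (hr : 0 ≤ r) (hs : 0 < s) (hc : 0 ≤ c) :
    P.real {ω | s ≤ r * (c + ∫ w, |w i * w j| * ‖w‖ ∂(empirical fun l => W l ω))} ≤
      r * (c + Emom Λ i j) / s := by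
  have hi := integrable_abs_coord_mul_coord_mul_norm h3 i j
  have he : ∀ ω, ∫ w, |w i * w j| * ‖w‖ ∂(empirical fun l => W l ω)
      = (1 / (D : ℝ)) * ∑ l, |W l ω i * W l ω j| * ‖W l ω‖ := fun ω =>
    integral_empirical _ (by fun_prop)
  simp only [he]
  have hint : Integrable (fun ω => (1 / (D : ℝ)) * ∑ l, |W l ω i * W l ω j| * ‖W l ω‖) P :=
    (integrable_finsetSum _ fun l _ => integrable_comp_of_hasLaw hW hi l).const_mul _
  have h := mul_meas_ge_le_integral_of_nonneg (μ := P)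
    (f := fun ω => r * (c + (1 / (D : ℝ)) * ∑ l, |W l ω i * W l ω j| * ‖W l ω‖))
    (Filter.Eventually.of_forall fun ω => by
      change (0 : ℝ) ≤ _
      positivity)
    (((integrable_const c).add hint).const_mul r) s
  rw [integral_const_mul, integral_add (integrable_const c) hint,
    integral_average_of_hasLaw hW hD hi] at h
  rw [le_div_iff₀' hs]
  refine h.trans (le_of_eq ?_)
  simp [Emom]

/-- The uniform error in a second derivative, controlled on a net. -/
theorem measureReal_hessError_le_of_net (hΛ : IsSpectralMeasure Λ k)
    (hmom : BernsteinCondition Λ S R) (hS : 0 < S) (hR : 0 < R) (hX : Convex ℝ X)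
    (hW : ∀ j, HasLaw (W j) Λ P) (hind : iIndepFun W P) (hD : 1 ≤ D) (i j : Fin d)
    {s : Finset (EuclideanSpace ℝ (Fin d))} {r e : ℝ} (hr : 0 ≤ r) (he : 0 < e)
    (hsX : ↑s ⊆ diffSet X) (hs : ∀ z ∈ diffSet X, ∃ c ∈ s, ‖z - c‖ ≤ r) :
    P.real {ω | ¬ ∃ t < 2 * e, ∀ z ∈ diffSet X, |hessError Λ (fun l => W l ω) i j z| ≤ t} ≤
      s.card * (2 * Real.exp (-(D * e ^ 2 / (2 * (S ^ 2 + R * e))))) +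
        r * (Dsup k X i j + Emom Λ i j) / e := by
  have h3 := memLp_of_bernstein hmom
  set A : EuclideanSpace ℝ (Fin d) → Set Ω := fun c =>
    {ω | e ≤ |hessError Λ (fun l => W l ω) i j c|} with hA
  set B : Set Ω := {ω | e ≤ r * (Dsup k X i j +
    ∫ w, |w i * w j| * ‖w‖ ∂(empirical fun l => W l ω))} with hB
  have hsub : {ω | ¬ ∃ t < 2 * e, ∀ z ∈ diffSet X,
      |hessError Λ (fun l => W l ω) i j z| ≤ t} ⊆ (⋃ c ∈ s, A c) ∪ B := by
    intro ω hω
    by_contra hcon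
    simp only [Set.mem_union, Set.mem_iUnion, hA, hB, Set.mem_ofPred_eq, not_or, not_exists,
      not_le] at hcon
    obtain ⟨h1, h2⟩ := hcon
    -- The error is below `e` on the net and varies by less than `e` from a net point. Exhibiting
    -- one bound `t < 2 e` for all `z` keeps the supremum over `X_Δ` strictly below `2 e`.
    refine hω ⟨e + r * (Dsup k X i j +
      ∫ w, |w i * w j| * ‖w‖ ∂(empirical fun l => W l ω)), by linarith, fun z hz => ?_⟩
    obtain ⟨c, hc, hzc⟩ := hs z hz
    have e1 := h1 c hc
    have e2 := hΛ.abs_cosInt_sub_le_Dsup h3 hX i j hz (hsX hc)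
    have e3 := abs_cosInt_sub_le_Emom (memLp_empirical (fun l => W l ω) (3 : ℕ)) i j z c
    have hL : 0 ≤ Dsup k X i j + ∫ w, |w i * w j| * ‖w‖ ∂(empirical fun l => W l ω) :=
      add_nonneg (Dsup_nonneg k X i j) (integral_nonneg fun w => by positivity)
    have e4 := mul_le_mul_of_nonneg_left hzc hL
    simp only [hessError] at e1 ⊢
    rw [abs_le] at e2 e3 ⊢
    rw [abs_lt] at e1
    constructor <;> nlinarith
  have hunion : P.real (⋃ c ∈ s, A c) ≤
      s.card * (2 * Real.exp (-(D * e ^ 2 / (2 * (S ^ 2 + R * e))))) := by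
    refine (measureReal_biUnion_finset_le _ _).trans ?_
    rw [← nsmul_eq_mul]
    exact Finset.sum_le_card_nsmul _ _ _ fun c _ =>
      measureReal_le_abs_hessError_le hmom hS hR hW hind hD he.le i j c
  refine (measureReal_mono hsub).trans ((measureReal_union_le _ _).trans (add_le_add hunion ?_))
  exact measureReal_le_lipschitz_le h3 hW hD i j hr he (Dsup_nonneg k X i j)

/-- The uniform error in a second derivative, with the radius of the net optimized. -/
theorem measureReal_hessError_le (hΛ : IsSpectralMeasure Λ k)
    (hmom : BernsteinCondition Λ S R) (hS : 0 < S) (hR : 0 < R) (hXc : IsCompact X)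
    (hX : Convex ℝ X) (hne : X.Nonempty)
    (hW : ∀ j, HasLaw (W j) Λ P) (hind : iIndepFun W P) (hD : 1 ≤ D) (i j : Fin d)
    {e η q : ℝ} (hη : 0 < η) (hηe : η ≤ e) (hq : 0 < q)
    (hexp : Real.exp (-(D * e ^ 2 / (2 * (S ^ 2 + R * e)))) ≤ q ^ (d + 1)) :
    P.real {ω | ¬ ∃ t < 2 * e, ∀ z ∈ diffSet X, |hessError Λ (fun l => W l ω) i j z| ≤ t} ≤
      16 * (Metric.diam X * (Dsup k X i j + Emom Λ i j) / η) ^ ((d : ℝ) / (d + 1)) * q +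
        2 * Real.exp (-(D * e ^ 2 / (2 * (S ^ 2 + R * e)))) := by
  have he : 0 < e := hη.trans_le hηe
  set G := Dsup k X i j + Emom Λ i j with hG
  have hG0 : 0 ≤ G := add_nonneg (Dsup_nonneg k X i j) (Emom_nonneg Λ i j)
  have hdiam : 0 ≤ Metric.diam X := Metric.diam_nonneg
  set U := Metric.diam X * G / η with hU
  have hU0 : 0 ≤ U := by positivity
  have hd1 : (0 : ℝ) < (d : ℝ) + 1 := by positivity
  have hnorm : ∀ z ∈ diffSet X, ‖z‖ ≤ Metric.diam X := by
    rintro _ ⟨x, hx, y, hy, rfl⟩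
    rw [← dist_eq_norm]
    exact Metric.dist_le_diam_of_mem hXc.isBounded hx hy
  set x := U ^ ((1 : ℝ) / (d + 1)) with hx
  have hx0 : 0 ≤ x := by positivity
  have hxU : x ^ (d + 1) = U := by
    rw [hx, ← Real.rpow_natCast, ← Real.rpow_mul hU0]
    push_cast
    rw [one_div_mul_cancel hd1.ne', Real.rpow_one]
  have hxd : U ^ ((d : ℝ) / (d + 1)) = x ^ d := by
    rw [hx, ← Real.rpow_natCast, ← Real.rpow_mul hU0]
    congr 1; ring
  rw [hxd]
  have hexp0 := Real.exp_pos (-(D * e ^ 2 / (2 * (S ^ 2 + R * e))))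
  -- For small `x`, including `U = 0`, the balanced radius would exceed twice the diameter. The
  -- one-point net `{0}` of radius `diam X` suffices, and its single Bernstein term is the last
  -- summand of the bound.
  rcases lt_or_ge x (2 * q) with hcase | hcase
  · obtain ⟨x0, hx0X⟩ := hne
    have h := measureReal_hessError_le_of_net hΛ hmom hS hR hX hW hind hD i j (s := {0})
      hdiam he (by
        rw [Finset.coe_singleton, Set.singleton_subset_iff]
        exact ⟨x0, hx0X, x0, hx0X, (sub_self _).symm⟩)
      (fun z hz => ⟨0, Finset.mem_singleton_self _, by rw [sub_zero]; exact hnorm z hz⟩)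
    rw [Finset.card_singleton, Nat.cast_one, one_mul] at h
    have h1 : Metric.diam X * G / e ≤ 16 * x ^ d * q := by
      calc Metric.diam X * G / e ≤ U := by rw [hU]; gcongr
        _ = x ^ d * x := by rw [← pow_succ, hxU]
        _ ≤ x ^ d * (2 * q) := by gcongr
        _ ≤ 16 * x ^ d * q := by
          have : 0 ≤ x ^ d * q := by positivity
          linarith
    linarith
  · have hxpos : 0 < x := by linarith
    have hUpos : 0 < U := by rw [← hxU]; positivity
    have hdpos : 0 < Metric.diam X := by
      rcases hdiam.eq_or_lt with h | h
      · rw [hU, ← h, zero_mul, zero_div] at hUpos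
        exact absurd hUpos (lt_irrefl _)
      · exact h
    -- Since `ρ ≤ 2`, the net has at most `(4 / ρ)^d = (x / q)^d` points. The union bound then gives
    -- `2 x^d q` and Markov `4 x^d q`, together below `16 x^d q`.
    set ρ := 4 * q / x with hρ
    have hρ0 : 0 < ρ := by positivity
    have hρ2 : ρ ≤ 2 := by rw [hρ, div_le_iff₀ hxpos]; linarith
    obtain ⟨s, hsX, hsnet, hcard⟩ := exists_finset_net hdiam
      (mul_pos hρ0 hdpos) (diffSet X) hnorm
    have h := measureReal_hessError_le_of_net hΛ hmom hS hR hX hW hind hD i j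
      (mul_pos hρ0 hdpos).le he hsX hsnet
    have hcard' : (s.card : ℝ) ≤ (x / q) ^ d := by
      refine hcard.trans ?_
      rw [finrank_euclideanSpace_fin]
      refine pow_le_pow_left₀ (by positivity) ?_ d
      calc (2 * Metric.diam X + ρ * Metric.diam X) / (ρ * Metric.diam X)
          = (2 + ρ) / ρ := by field_simp
        _ ≤ 4 / ρ := by gcongr; linarith
        _ = x / q := by rw [hρ]; field_simp
    have h1 : s.card * (2 * Real.exp (-(D * e ^ 2 / (2 * (S ^ 2 + R * e))))) ≤ 2 * x ^ d * q := by
      calc _ ≤ (x / q) ^ d * (2 * q ^ (d + 1)) := by gcongr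
        _ = _ := by rw [div_pow, pow_succ]; field_simp
    have h2 : ρ * Metric.diam X * G / e ≤ 4 * x ^ d * q := by
      calc ρ * Metric.diam X * G / e ≤ ρ * Metric.diam X * G / η := by gcongr
        _ = ρ * x ^ (d + 1) := by rw [hxU, hU]; ring
        _ = _ := by rw [hρ, pow_succ]; field_simp
    have : 0 ≤ x ^ d * q := by positivity
    linarith

/-- The tail of the empirical second moment. -/
theorem measureReal_le_norm_sq_le (hmom : BernsteinCondition Λ S R) (hd : 1 ≤ d) (hS : 0 < S)
    (hR : 0 < R) (hW : ∀ j, HasLaw (W j) Λ P) (hind : iIndepFun W P) (hD : 1 ≤ D) {τ : ℝ}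
    (hτ : 0 ≤ τ) :
    P.real {ω | sigmaSq Λ + d * τ ≤ (1 / (D : ℝ)) * ∑ l, ‖W l ω‖ ^ 2} ≤
      d * Real.exp (-(D * τ ^ 2 / (2 * (S ^ 2 + R * τ)))) := by
  have h3 := memLp_of_bernstein hmom
  have h2 : MemLp id (2 : ℕ) Λ := h3.mono_exponent (by exact_mod_cast (by norm_num : 2 ≤ 3))
  set A : Fin d → Set Ω := fun i =>
    {ω | (∫ w, w i * w i ∂Λ) + τ ≤ (1 / (D : ℝ)) * ∑ l, W l ω i * W l ω i} with hA
  have hsub : {ω | sigmaSq Λ + d * τ ≤ (1 / (D : ℝ)) * ∑ l, ‖W l ω‖ ^ 2} ⊆ ⋃ i, A i := by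
    intro ω hω
    -- As `σ²` is the sum of the coordinate second moments, an excess of `d τ` forces an excess of
    -- `τ` in some coordinate.
    by_contra hcon
    simp only [Set.mem_iUnion, hA, Set.mem_ofPred_eq, not_exists, not_le] at hcon
    have : Nonempty (Fin d) := ⟨⟨0, hd⟩⟩
    have hlt := Finset.sum_lt_sum_of_nonempty (Finset.univ_nonempty (α := Fin d))
      fun i _ => hcon i
    rw [Finset.sum_add_distrib, ← sigmaSq_eq h2, Finset.sum_const, Finset.card_univ,
      Fintype.card_fin, nsmul_eq_mul, ← Finset.mul_sum, Finset.sum_comm] at hlt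
    have hω' : sigmaSq Λ + d * τ ≤ (1 / (D : ℝ)) * ∑ l, ‖W l ω‖ ^ 2 := hω
    simp only [EuclideanSpace.real_norm_sq_eq] at hω'
    simp only [pow_two] at hω'
    linarith
  refine (measureReal_mono hsub).trans ((measureReal_iUnion_fintype_le _).trans ?_)
  have hi : ∀ i, P.real (A i) ≤ Real.exp (-(D * τ ^ 2 / (2 * (S ^ 2 + R * τ)))) := fun i =>
    bernstein (hmom.bernsteinMoments i i (f := fun w => w i * w i) (by fun_prop) fun w => le_rfl)
      (by fun_prop) hS hR hW hind hD hτ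
  refine (Finset.sum_le_sum fun i _ => hi i).trans (le_of_eq ?_)
  simp

end TailBounds

/-! ### Matching the constants of the tail bound -/

section Assembly

variable {d D m : ℕ} {k : EuclideanSpace ℝ (Fin d) → EuclideanSpace ℝ (Fin d) → ℝ}
  {Λ : Measure (EuclideanSpace ℝ (Fin d))} {S R V ε : ℝ}
  {X : Set (EuclideanSpace ℝ (Fin d))}

theorem betaConst_pos (hd : 1 ≤ d) (hm : 1 ≤ m) (hV : 0 < V) : 0 < betaConst Λ m V := by
  have h1 : (0 : ℝ) < max (lipConst Λ ^ 2) 1 := lt_max_of_lt_right one_pos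
  have h2 : (0 : ℝ) < max (sigmaSq Λ) d := lt_max_of_lt_right (by positivity)
  have h3 : (0 : ℝ) < m := by positivity
  unfold betaConst
  positivity

/-- Both regimes of the tail bound in a common form. -/
theorem exists_tailBound_eq (k : EuclideanSpace ℝ (Fin d) → EuclideanSpace ℝ (Fin d) → ℝ)
    (Λ : Measure (EuclideanSpace ℝ (Fin d))) (X : Set (EuclideanSpace ℝ (Fin d))) (S R : ℝ)
    (D : ℕ) (hd : 1 ≤ d) (hm : 1 ≤ m) (hV : 0 < V) (hε : 0 < ε) :
    ∃ η τ : ℝ, 0 < η ∧ 1 ≤ τ ∧ η ≤ τ ∧ η * τ ^ (m - 1) * betaConst Λ m V = ε ∧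
      tailBound k Λ X S R D m V ε = m * ((Cconst k Λ X * (1 / η) ^ ((d : ℝ) / (d + 1))
        + addConst d m) * Real.exp (-(D * (η ^ 2 / τ) / (2 * (S ^ 2 + R)) / (d + 1)))) := by
  have hβ : 0 < betaConst Λ m V := betaConst_pos hd hm hV
  have hm0 : (m : ℝ) ≠ 0 := by positivity
  have hden : 2 * ((d : ℝ) + 1) * (S ^ 2 + R) = 2 * (S ^ 2 + R) * (d + 1) := by ring
  have hθ : 0 < ε / betaConst Λ m V := by positivity
  rcases lt_or_ge ε (betaConst Λ m V) with h | h
  · refine ⟨ε / betaConst Λ m V, 1, hθ, le_rfl, ((div_lt_one hβ).2 h).le, ?_, ?_⟩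
    · rw [one_pow, mul_one, div_mul_cancel₀ _ hβ.ne']
    · rw [tailBound, if_pos h, one_div_div, hden, div_div, div_one]
      congr 3
      rw [neg_mul, div_mul_eq_mul_div]
  · set η := (ε / betaConst Λ m V) ^ ((1 : ℝ) / m) with hη
    have hη0 : 0 < η := by positivity
    have hη1 : 1 ≤ η := Real.one_le_rpow ((one_le_div hβ).2 h) (by positivity)
    have hpow : η ^ m = ε / betaConst Λ m V := by
      rw [hη, ← Real.rpow_natCast, ← Real.rpow_mul hθ.le, one_div_mul_cancel hm0, Real.rpow_one]
    refine ⟨η, η, hη0, hη1, le_rfl, ?_, ?_⟩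
    · rw [← pow_succ', Nat.sub_add_cancel hm, hpow, div_mul_cancel₀ _ hβ.ne']
    · rw [tailBound, if_neg (not_lt.2 h), ← hη]
      have e1 : (betaConst Λ m V / ε) ^ ((d : ℝ) / ((d + 1) * m))
          = (1 / η) ^ ((d : ℝ) / (d + 1)) := by
        rw [← one_div_div, ← hpow, ← one_div_pow, ← Real.rpow_natCast,
          ← Real.rpow_mul (by positivity)]
        congr 1
        field_simp
      have e2 : η ^ 2 / η = η := by field_simp
      rw [e1, e2, hden, div_div]
      congr 3
      rw [neg_mul, div_mul_eq_mul_div]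

theorem addConst_pos (hd : 1 ≤ d) (m : ℕ) : 0 < addConst d m := by
  unfold addConst
  split_ifs
  · norm_num
  · exact_mod_cast hd

theorem Cconst_nonneg (k : EuclideanSpace ℝ (Fin d) → EuclideanSpace ℝ (Fin d) → ℝ)
    (Λ : Measure (EuclideanSpace ℝ (Fin d))) (X : Set (EuclideanSpace ℝ (Fin d))) :
    0 ≤ Cconst k Λ X := by
  have : 0 ≤ Metric.diam X := Metric.diam_nonneg
  refine mul_nonneg (by positivity) (Finset.sum_nonneg fun i _ => Finset.sum_nonneg fun j _ => ?_)
  exact Real.rpow_nonneg (add_nonneg (Dsup_nonneg k X i j) (Emom_nonneg Λ i j)) _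

/-- The sum of the contributions of the nets to the tail bound. -/
theorem sum_le_Cconst (k : EuclideanSpace ℝ (Fin d) → EuclideanSpace ℝ (Fin d) → ℝ)
    (Λ : Measure (EuclideanSpace ℝ (Fin d))) (X : Set (EuclideanSpace ℝ (Fin d))) {η : ℝ}
    (hη : 0 < η) :
    ∑ i, ∑ j, 16 * (Metric.diam X * (Dsup k X i j + Emom Λ i j) / η) ^ ((d : ℝ) / (d + 1)) ≤
      Cconst k Λ X * (1 / η) ^ ((d : ℝ) / (d + 1)) := by
  set p := (d : ℝ) / (d + 1)
  have hdiam : 0 ≤ Metric.diam X := Metric.diam_nonneg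
  have hG : ∀ i j, 0 ≤ Dsup k X i j + Emom Λ i j := fun i j =>
    add_nonneg (Dsup_nonneg k X i j) (Emom_nonneg Λ i j)
  have e : ∑ i, ∑ j, 16 * (Metric.diam X * (Dsup k X i j + Emom Λ i j) / η) ^ p
      = 1 * (16 * Metric.diam X ^ p * (∑ i, ∑ j, (Dsup k X i j + Emom Λ i j) ^ p)
        * (1 / η) ^ p) := by
    rw [one_mul, Finset.mul_sum, Finset.sum_mul]
    refine Finset.sum_congr rfl fun i _ => ?_
    rw [Finset.mul_sum, Finset.sum_mul]
    refine Finset.sum_congr rfl fun j _ => ?_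
    rw [div_eq_mul_one_div, Real.mul_rpow (mul_nonneg hdiam (hG i j)) (by positivity),
      Real.mul_rpow hdiam (hG i j)]
    ring
  have h2 : (1 : ℝ) ≤ 2 ^ ((1 : ℝ) / (d + 1)) := Real.one_le_rpow (by norm_num) (by positivity)
  have hsum : 0 ≤ ∑ i, ∑ j, (Dsup k X i j + Emom Λ i j) ^ p :=
    Finset.sum_nonneg fun i _ => Finset.sum_nonneg fun j _ => Real.rpow_nonneg (hG i j) _
  rw [e]
  refine (mul_le_mul_of_nonneg_right h2 (by positivity)).trans (le_of_eq ?_)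
  rw [Cconst]
  ring

/-- The Bernstein exponents beat the exponent of the tail bound. -/
theorem exp_hess_le (hS : 0 < S) (hR : 0 < R) {η τ : ℝ} (hη : 0 < η) (hτ : 1 ≤ τ) (hητ : η ≤ τ)
    (D : ℕ) {M : ℕ} (hM : 1 ≤ M) :
    Real.exp (-(D * (η * M) ^ 2 / (2 * (S ^ 2 + R * (η * M))))) ≤
      Real.exp (-(D * (η ^ 2 / τ) / (2 * (S ^ 2 + R)))) ^ M := by
  rw [← Real.exp_nat_mul]
  refine Real.exp_le_exp.2 ?_
  have hM' : (1 : ℝ) ≤ M := by exact_mod_cast hM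
  have hτ0 : 0 < τ := by linarith
  have hM0 : (0 : ℝ) < M := by linarith
  have hS2 : 0 < S ^ 2 := by positivity
  -- Since `S² + R η M ≤ M τ (S² + R)`, one of the two factors `M` in the numerator survives and
  -- becomes the power on the right.
  have key : M * (η ^ 2 / τ) / (S ^ 2 + R) ≤ (η * M) ^ 2 / (S ^ 2 + R * (η * M)) := by
    rw [mul_div_assoc', div_div, div_le_div_iff₀ (by positivity) (by positivity)]
    have h1 : S ^ 2 + R * (η * M) ≤ M * (τ * (S ^ 2 + R)) := by
      have a1 : S ^ 2 * 1 ≤ S ^ 2 * (M * τ) := by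
        gcongr
        exact one_le_mul_of_one_le_of_one_le hM' hτ
      have a2 : R * (η * M) ≤ R * (τ * M) := by gcongr
      linarith
    calc M * η ^ 2 * (S ^ 2 + R * (η * M)) ≤ M * η ^ 2 * (M * (τ * (S ^ 2 + R))) := by gcongr
      _ = _ := by ring
  have h2 := mul_le_mul_of_nonneg_left key (by positivity : (0 : ℝ) ≤ D / 2)
  calc _ = -(D / 2 * ((η * M) ^ 2 / (S ^ 2 + R * (η * M)))) := by rw [div_mul_div_comm]
    _ ≤ -(D / 2 * (M * (η ^ 2 / τ) / (S ^ 2 + R))) := neg_le_neg h2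
    _ = _ := by rw [div_mul_div_comm]; ring

/-- The case `M = 1` at level `τ`, combined with `η² / τ ≤ τ² / τ`. -/
theorem exp_norm_le (hS : 0 < S) (hR : 0 < R) {η τ : ℝ} (hη : 0 < η) (hτ : 1 ≤ τ) (hητ : η ≤ τ)
    (D : ℕ) :
    Real.exp (-(D * τ ^ 2 / (2 * (S ^ 2 + R * τ)))) ≤
      Real.exp (-(D * (η ^ 2 / τ) / (2 * (S ^ 2 + R)))) := by
  have h := exp_hess_le hS hR (by linarith : 0 < τ) hτ le_rfl D (M := 1) le_rfl
  rw [Nat.cast_one, mul_one, pow_one] at h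
  refine h.trans (Real.exp_le_exp.2 ?_)
  have : 0 < τ := by linarith
  gcongr

/-- The net at the origin and the empirical second moments are absorbed by the additive
constant of the tail bound. -/
theorem absorb_le (hd : 1 ≤ d) (hm : 1 ≤ m) {q A B : ℝ} (hq : 0 < q)
    (hA : A ≤ (q ^ (d + 1)) ^ (m.factorial ^ 2)) (hB : B ≤ q ^ (d + 1))
    (hsmall : m * (addConst d m * q) < 1) :
    d ^ 2 * (2 * A) + (if 2 ≤ m then d * B else 0) ≤ addConst d m * q := by
  have hd' : (1 : ℝ) ≤ d := by exact_mod_cast hd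
  rcases Nat.lt_or_ge m 2 with h | h
  · obtain rfl : m = 1 := by omega
    rw [if_neg (by norm_num)]
    simp only [Nat.factorial_one, one_pow, pow_one] at hA
    rcases Nat.lt_or_ge d 2 with h' | h'
    -- Here `2 A ≤ 2 q²`. With additive constant 1, nontriviality would give only `q < 1`, which
    -- does not imply `2 q² ≤ q`; hence the exceptional constant 2.
    · obtain rfl : d = 1 := by omega
      simp only [addConst, and_self, if_true, Nat.cast_one, one_mul] at hsmall ⊢
      have : q ^ (1 + 1) ≤ q := pow_le_of_le_one hq.le (by linarith) (by norm_num)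
      linarith
    · have hne : ¬ (d = 1 ∧ 1 = 1) := by omega
      rw [addConst, if_neg hne] at hsmall ⊢
      have hd2 : (2 : ℝ) ≤ d := by exact_mod_cast h'
      rw [Nat.cast_one, one_mul] at hsmall
      have hq2 : 2 * q ≤ 1 := by nlinarith
      have hpow : q ^ (d + 1) ≤ q ^ 3 := pow_le_pow_of_le_one hq.le (by linarith) (by omega)
      calc (d : ℝ) ^ 2 * (2 * A) + 0 ≤ d ^ 2 * (2 * q ^ 3) + 0 := by gcongr; exact hA.trans hpow
        _ = (d * q) * ((d * q) * (2 * q)) := by ring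
        _ ≤ (d * q) * (1 * 1) := by gcongr
        _ = _ := by ring
  · rw [if_pos h]
    have hne : ¬ (d = 1 ∧ m = 1) := by omega
    rw [addConst, if_neg hne] at hsmall ⊢
    have hm2 : (2 : ℝ) ≤ m := by exact_mod_cast h
    have hdq : 0 < d * q := by positivity
    have h1 : 2 * (d * q) ≤ 1 := by nlinarith
    have hq2 : 2 * q ≤ 1 := by nlinarith
    have hq1 : q ≤ 1 := by linarith
    -- For `d = 1` the power `d + 1` alone would give `A ≤ q²`, too weak here; the gain `(m!)² ≥ 4`
    -- in the exponent yields `q³`.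
    have hM : 4 ≤ m.factorial ^ 2 := by
      have : 2 ≤ m.factorial := h.trans (Nat.self_le_factorial m)
      nlinarith
    have hA' : A ≤ q ^ 3 := by
      refine hA.trans ?_
      rw [← pow_mul]
      exact pow_le_pow_of_le_one hq.le hq1 (by nlinarith)
    have hB' : B ≤ q ^ 2 := hB.trans (pow_le_pow_of_le_one hq.le hq1 (by omega))
    calc (d : ℝ) ^ 2 * (2 * A) + d * B ≤ d ^ 2 * (2 * q ^ 3) + d * q ^ 2 := by gcongr
      _ = (d * q) * ((2 * (d * q)) * q + q) := by ring
      _ ≤ (d * q) * (1 * q + q) := by gcongr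
      _ ≤ (d * q) * 1 := by gcongr; linarith
      _ = _ := mul_one _

/-- Uniform control of the second derivatives, and of the empirical second moments, controls the
signature kernels. -/
theorem uniformError_lt [IsProbabilityMeasure Λ] (hΛ : IsSpectralMeasure Λ k)
    (h2 : MemLp id (2 : ℕ) Λ) (hX : Convex ℝ X) (hne : X.Nonempty) (hd : 1 ≤ d) (hm : 1 ≤ m)
    (hV : 0 < V) {η τ : ℝ} (hη : 0 < η) (hτ : 1 ≤ τ)
    (hε : η * τ ^ (m - 1) * betaConst Λ m V = ε) (W : Fin m → Fin D → EuclideanSpace ℝ (Fin d))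
    (hhess : ∀ p i j, ∃ t < 2 * (η * (m.factorial ^ 2 : ℕ)),
      ∀ z ∈ diffSet X, |hessError Λ (W p) i j z| ≤ t)
    (hnorm : 2 ≤ m → ∀ p, (1 / (D : ℝ)) * ∑ l, ‖W p l‖ ^ 2 < sigmaSq Λ + d * τ) :
    uniformError k X V W < ENNReal.ofReal ε := by
  have hd' : (1 : ℝ) ≤ d := by exact_mod_cast hd
  choose f hf hfz using hhess
  have : Nonempty (Fin m × Fin d × Fin d) := ⟨⟨0, hm⟩, ⟨0, hd⟩, ⟨0, hd⟩⟩
  -- A maximum over finitely many indices preserves the strict inequality.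
  set t := Finset.univ.sup' Finset.univ_nonempty
    (fun q : Fin m × Fin d × Fin d => f q.1 q.2.1 q.2.2) with ht
  have ht_lt : t < 2 * (η * (m.factorial ^ 2 : ℕ)) :=
    (Finset.sup'_lt_iff _).2 fun q _ => hf _ _ _
  have htz : ∀ p i j, ∀ z ∈ diffSet X, |hessError Λ (W p) i j z| ≤ t := fun p i j z hz =>
    (hfz p i j z hz).trans (Finset.le_sup' (fun q : Fin m × Fin d × Fin d => f q.1 q.2.1 q.2.2)
      (Finset.mem_univ (p, i, j)))
  obtain ⟨x0, hx0⟩ := hne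
  have ht0 : 0 ≤ t := (abs_nonneg _).trans
    (htz ⟨0, hm⟩ ⟨0, hd⟩ ⟨0, hd⟩ (x0 - x0) ⟨x0, hx0, x0, hx0, rfl⟩)
  set α := max (lipConst Λ ^ 2) 1 with hα
  set s := max (sigmaSq Λ) d with hs
  set γ := sigmaSq Λ + d * τ with hγ
  have hσ : 0 ≤ sigmaSq Λ := integral_nonneg fun w => by positivity
  have hα1 : 1 ≤ α := le_max_right _ _
  have hγ1 : 1 ≤ γ := by nlinarith
  have hs1 : (d : ℝ) ≤ s := le_max_right _ _
  -- Source of `τ^(m-1)` and of `m - 1` of the factors 2 in `β`; the remaining 2 comes from the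
  -- Hessian threshold.
  have hγs : γ ≤ 2 * τ * s := by
    have a1 : sigmaSq Λ ≤ s := le_max_left _ _
    have a2 : d * τ ≤ s * τ := by gcongr
    nlinarith
  have hK : 0 < α * γ := by positivity
  have hbound : ∀ x y : PSeq X, x.oneVar ≤ V → y.oneVar ≤ V →
      |sigKernel k m x y - rfsfKernel W x y| ≤
        m * (d * t) * (α * γ) ^ (m - 1) * (V ^ m / m.factorial) ^ 2 := by
    intro x y hx hy
    rw [rfsfKernel_eq_sum]
    have hk : k = fun x y => cosInt Λ (fun _ => 1) 0 (x - y) := by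
      ext x y; exact hΛ.eq_cosInt x y
    refine abs_sigKernel_sub_le hm (by positivity) hK x y hx hy (fun i j => ?_)
      (fun hm2 p i j => ?_) (fun p i j => ?_)
    · rw [hk]
      refine (abs_crossDiff_cosInt_le h2 hX x y i j).trans
        ((integral_abs_inner_mul_inner_le h2 _ _).trans ?_)
      gcongr
      calc lipConst Λ ^ 2 ≤ α * 1 := by rw [mul_one]; exact le_max_left _ _
        _ ≤ α * γ := by gcongr
    · refine (abs_crossDiff_rffKernel_le (W p) hX x y i j).trans ?_
      refine mul_le_mul_of_nonneg_right ?_ (by positivity)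
      calc _ ≤ 1 * γ := by rw [one_mul]; exact (hnorm hm2 p).le
        _ ≤ α * γ := by gcongr
    · have hk' : rffKernel (W p)
          = fun x y => cosInt (empirical (W p)) (fun _ => 1) 0 (x - y) := by
        ext x y; exact rffKernel_eq_cosInt (W p) x y
      rw [hk, hk']
      refine abs_crossDiff_sub_le h2 (memLp_empirical (W p) _) hX (fun z hz i j => ?_) x y i j
      rw [abs_sub_comm]
      exact htz p i j z hz
  have hlt : m * (d * t) * (α * γ) ^ (m - 1) * (V ^ m / m.factorial) ^ 2 < ε := by
    have hm0 : (0 : ℝ) < m := by positivity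
    have hd0 : (0 : ℝ) < d := by linarith
    have hfac : (0 : ℝ) < m.factorial := by positivity
    obtain ⟨n, rfl⟩ : ∃ n, m = n + 1 := ⟨m - 1, by omega⟩
    rw [Nat.add_sub_cancel] at hε ⊢
    -- The `(m!)²` in the Hessian threshold cancels the `1 / m!` from each of the two simplex sums.
    calc _ < ((n + 1 : ℕ) : ℝ) * (d * (2 * (η * ((n + 1).factorial ^ 2 : ℕ)))) * (α * γ) ^ n *
          (V ^ (n + 1) / (n + 1).factorial) ^ 2 := by gcongr
      _ = ((n + 1 : ℕ) : ℝ) * (2 * η) * V ^ (2 * (n + 1)) * ((1 * d) * (α * γ) ^ n) := by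
        push_cast
        field_simp
        ring
      _ ≤ ((n + 1 : ℕ) : ℝ) * (2 * η) * V ^ (2 * (n + 1)) *
          ((α * s) * (α * (2 * τ * s)) ^ n) := by gcongr
      _ = ε := by
        rw [← hε, betaConst, ← hα, ← hs]
        simp only [mul_pow, pow_mul, pow_succ]
        ring
  refine lt_of_le_of_lt ?_ ((ENNReal.ofReal_lt_ofReal_iff_of_nonneg (by positivity)).2 hlt)
  exact iSup_le fun x => iSup_le fun y => iSup_le fun hx => iSup_le fun hy =>
    ENNReal.ofReal_le_ofReal (hbound x y hx hy)

end Assembly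

end RFSF

/-! ### The main theorem -/

open RFSF in
theorem mainTheorem1 {d : ℕ} (hd : 1 ≤ d)
    (k : EuclideanSpace ℝ (Fin d) → EuclideanSpace ℝ (Fin d) → ℝ)
    (hker : RFSF.IsKernel k) (hcont : Continuous (Function.uncurry k))
    (hbdd : ∃ B : ℝ, ∀ x y, |k x y| ≤ B) (htrans : RFSF.IsTranslationInvariant k)
    (Λ : Measure (EuclideanSpace ℝ (Fin d))) [IsProbabilityMeasure Λ]
    (hΛ : RFSF.IsSpectralMeasure Λ k)
    (S R : ℝ) (hS : 0 < S) (hR : 0 < R) (hmom : RFSF.BernsteinCondition Λ S R)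
    (X : Set (EuclideanSpace ℝ (Fin d))) (hXcompact : IsCompact X) (hXconvex : Convex ℝ X) :
    -- the quantities `σ_Λ²`, `L`, `E_{i,j}`, `D_{i,j}` are well defined and finite
    (Integrable (fun w : EuclideanSpace ℝ (Fin d) => ‖w‖ ^ 2) Λ ∧
      (∀ i j : Fin d, Integrable (fun w : EuclideanSpace ℝ (Fin d) => w i * w j) Λ) ∧
      (∀ i j : Fin d, Integrable (fun w : EuclideanSpace ℝ (Fin d) => |w i * w j| * ‖w‖) Λ) ∧
      ContDiff ℝ 3 (RFSF.profile k) ∧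
      (∀ i j : Fin d, BddAbove (RFSF.gradNorms k X i j))) ∧
    -- the concentration inequality
    (∀ (m D : ℕ), 1 ≤ m → 1 ≤ D → ∀ V ε : ℝ, 0 < V → 0 < ε →
      ∀ (Ω : Type*) [MeasurableSpace Ω] (P : Measure Ω) [IsProbabilityMeasure P]
        (W : Fin m → Fin D → Ω → EuclideanSpace ℝ (Fin d)),
        (∀ p j, HasLaw (W p j) Λ P) →
        iIndepFun (fun q : Fin m × Fin D => W q.1 q.2) P →
        P.real {ω | ENNReal.ofReal ε ≤ RFSF.uniformError k X V (fun p j => W p j ω)} ≤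
          RFSF.tailBound k Λ X S R D m V ε) := by
  have h3 := memLp_of_bernstein hmom
  have h2 : MemLp id (2 : ℕ) Λ := h3.mono_exponent (by exact_mod_cast (by norm_num : 2 ≤ 3))
  refine ⟨⟨?_, integrable_coord_mul_coord h3, integrable_abs_coord_mul_coord_mul_norm h3,
    hΛ.contDiff_profile h3, hΛ.bddAbove_gradNorms h3 X⟩, ?_⟩
  · exact integrable_of_le_norm_pow h2 (n := 2) le_rfl (by fun_prop) (C := 1) fun w => by simp
  intro m D hm hD V ε hV hε Ω _ P _ W hW hind
  obtain ⟨η, τ, hη, hτ, hητ, hηε, htail⟩ :=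
    exists_tailBound_eq k Λ X S R D hd hm hV hε
  rw [htail]
  set b := D * (η ^ 2 / τ) / (2 * (S ^ 2 + R)) with hb
  -- The exponential of the tail bound; its power `q^(d+1)` is the size of a single Bernstein
  -- estimate.
  set q := Real.exp (-(b / (d + 1))) with hq
  set C := Cconst k Λ X * (1 / η) ^ ((d : ℝ) / (d + 1)) with hC
  have hq0 : 0 < q := Real.exp_pos _
  have hC0 : 0 ≤ C := mul_nonneg (Cconst_nonneg k Λ X) (by positivity)
  have hc0 := addConst_pos hd m
  have hm0 : (0 : ℝ) < m := by positivity
  have hqb : q ^ (d + 1) = Real.exp (-b) := by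
    rw [hq, ← Real.exp_nat_mul]
    congr 1
    push_cast
    field_simp
  rcases X.eq_empty_or_nonempty with rfl | hne
  · have hempty : {ω | ENNReal.ofReal ε ≤ uniformError k (∅ : Set (EuclideanSpace ℝ (Fin d))) V
        (fun p j => W p j ω)} = ∅ := by
      refine Set.eq_empty_of_forall_notMem fun ω hω => ?_
      have : IsEmpty (PSeq (∅ : Set (EuclideanSpace ℝ (Fin d)))) := ⟨fun x => x.mem 0⟩
      have hω' : ENNReal.ofReal ε ≤ uniformError k (∅ : Set (EuclideanSpace ℝ (Fin d))) V
        (fun p j => W p j ω) := hω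
      rw [uniformError, iSup_of_empty, bot_eq_zero, nonpos_iff_eq_zero,
        ENNReal.ofReal_eq_zero] at hω'
      linarith
    rw [hempty, measureReal_empty]
    positivity
  -- If the additive part alone reaches 1 the bound is trivial; otherwise `q` is small enough for
  -- the absorption.
  rcases le_or_gt 1 (m * (addConst d m * q)) with hbig | hsmall
  · refine measureReal_le_one.trans (hbig.trans ?_)
    gcongr
    linarith
  set M := m.factorial ^ 2 with hM
  have hM1 : 1 ≤ M := Nat.one_le_pow _ _ (Nat.factorial_pos m)
  set e := η * (M : ℝ) with he
  have hηe : η ≤ e := le_mul_of_one_le_right hη.le (by exact_mod_cast hM1)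
  set A := Real.exp (-(D * e ^ 2 / (2 * (S ^ 2 + R * e)))) with hA
  set B := Real.exp (-(D * τ ^ 2 / (2 * (S ^ 2 + R * τ)))) with hB
  have hAM : A ≤ (q ^ (d + 1)) ^ M := by
    rw [hqb]; exact exp_hess_le hS hR hη hτ hητ D hM1
  have hA1 : A ≤ q ^ (d + 1) := by
    refine hAM.trans (pow_le_of_le_one (by positivity) ?_ (by omega))
    rw [hqb]
    refine Real.exp_le_one_iff.2 (neg_nonpos.2 ?_)
    have : 0 < τ := by linarith
    positivity
  have hB1 : B ≤ q ^ (d + 1) := by rw [hqb]; exact exp_norm_le hS hR hη hτ hητ D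
  have hindp : ∀ p, iIndepFun (fun l => W p l) P := fun p =>
    hind.precomp (g := fun l : Fin D => (p, l)) fun _ _ h => (Prod.mk.inj h).2
  set Bad : Fin m → Fin d → Fin d → Set Ω := fun p i j =>
    {ω | ¬ ∃ t < 2 * e, ∀ z ∈ diffSet X, |hessError Λ (fun l => W p l ω) i j z| ≤ t} with hBad
  set BadN : Fin m → Set Ω := fun p =>
    {ω | 2 ≤ m ∧ sigmaSq Λ + d * τ ≤ (1 / (D : ℝ)) * ∑ l, ‖W p l ω‖ ^ 2} with hBadN
  -- Monotonicity and subadditivity of `P` hold for arbitrary sets, so measurability of the supremum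
  -- plays no role.
  have hsub : {ω | ENNReal.ofReal ε ≤ uniformError k X V (fun p j => W p j ω)} ⊆
      ⋃ p, ((⋃ i, ⋃ j, Bad p i j) ∪ BadN p) := by
    intro ω hω
    by_contra hcon
    simp only [Set.mem_iUnion, Set.mem_union, not_exists, not_or] at hcon
    refine absurd (uniformError_lt hΛ h2 hXconvex hne hd hm hV hη hτ hηε
      (fun p j => W p j ω) (fun p i j => not_not.1 ((hcon p).1 i j)) fun hm2 p => ?_) (not_lt.2 hω)
    exact not_le.1 fun h => (hcon p).2 ⟨hm2, h⟩
  have hBadle : ∀ p i j, P.real (Bad p i j) ≤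
      16 * (Metric.diam X * (Dsup k X i j + Emom Λ i j) / η) ^ ((d : ℝ) / (d + 1)) * q + 2 * A :=
    fun p i j => measureReal_hessError_le hΛ hmom hS hR hXcompact hXconvex hne (hW p) (hindp p) hD
      i j hη hηe hq0 hA1
  have hBadNle : ∀ p, P.real (BadN p) ≤ if 2 ≤ m then d * B else 0 := by
    intro p
    split_ifs with hm2
    · refine (measureReal_mono ?_).trans
        (measureReal_le_norm_sq_le hmom hd hS hR (hW p) (hindp p) hD (by linarith))
      exact fun ω hω => hω.2
    · have : BadN p = ∅ := Set.eq_empty_of_forall_notMem fun ω hω => hm2 hω.1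
      rw [this, measureReal_empty]
  have hp : ∀ p, P.real ((⋃ i, ⋃ j, Bad p i j) ∪ BadN p) ≤ (C + addConst d m) * q := by
    intro p
    calc _ ≤ P.real (⋃ i, ⋃ j, Bad p i j) + P.real (BadN p) := measureReal_union_le _ _
      _ ≤ (∑ i, ∑ j, P.real (Bad p i j)) + (if 2 ≤ m then d * B else 0) := by
        refine add_le_add ((measureReal_iUnion_fintype_le _).trans ?_) (hBadNle p)
        exact Finset.sum_le_sum fun i _ => measureReal_iUnion_fintype_le _
      _ ≤ (∑ i, ∑ j, (16 * (Metric.diam X * (Dsup k X i j + Emom Λ i j) / η) ^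
            ((d : ℝ) / (d + 1)) * q + 2 * A)) + (if 2 ≤ m then d * B else 0) := by
        gcongr with i _ j _
        exact hBadle p i j
      _ = (∑ i, ∑ j, 16 * (Metric.diam X * (Dsup k X i j + Emom Λ i j) / η) ^
            ((d : ℝ) / (d + 1))) * q
            + (d ^ 2 * (2 * A) + (if 2 ≤ m then d * B else 0)) := by
        simp only [Finset.sum_add_distrib, Finset.sum_mul, Finset.sum_const, Finset.card_univ,
          Fintype.card_fin, nsmul_eq_mul]
        ring
      _ ≤ C * q + addConst d m * q := by
        refine add_le_add ?_ (absorb_le hd hm hq0 hAM hB1 hsmall)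
        gcongr
        exact sum_le_Cconst k Λ X hη
      _ = _ := by ring
  calc _ ≤ P.real (⋃ p, ((⋃ i, ⋃ j, Bad p i j) ∪ BadN p)) := measureReal_mono hsub
    _ ≤ ∑ p, P.real ((⋃ i, ⋃ j, Bad p i j) ∪ BadN p) := measureReal_iUnion_fintype_le _
    _ ≤ ∑ _p : Fin m, (C + addConst d m) * q := Finset.sum_le_sum fun p _ => hp p
    _ = _ := by simp
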